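/- Let $M$ be a non-empty (pseudo-)Riemannian spin manifold of even dimension $2n$, $n\ge 1$, with metric $g$ having $t$ time-like directions. Spin structures are understood as structures for the group $\mathrm{Spin}$ of even products of vectors of spinor norm $+1$. Let $S$ be the bundle of complex Dirac spinors (rank $2^n$), with Clifford multiplication $\gamma$, $\gamma(X)\gamma(Y)+\gamma(Y)\gamma(X)=-2g(X,Y)$, and Levi-Civita connection $\nabla$. Let $C$ be a charge conjugation on $S$, i.e. a nondegenerate spin-invariant complex bilinear form with $C(\varphi,\psi)=\Delta_0C(\psi,\varphi)$ and $C(\varphi,\gamma_\mu\psi)=\Delta_1C(\psi,\gamma_\mu\varphi)$, where $\Delta_0,\Delta_1\in\{\pm1\}$. For a connection $D$ on $S$ let $D^C$ be the connection with $X(C(\varphi,\psi))=C(D_X\varphi,\psi)+C(\varphi,D^C_X\psi)$ and put $(\hat D_Z\gamma)(X)\xi=D_Z(\gamma(X)\xi)-\gamma(\nabla_ZX)\xi-\gamma(X)D^C_Z\xi$; $D$ is called admissible if $(\hat D_Z\gamma)(X)=-(\hat D_X\gamma)(Z)$ for all vector fields $X,Z$. Let $\gamma^*=\gamma^1\cdots\gamma^{2n}$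 if $2n-2t\equiv0\bmod 4$ and $\gamma^*=i\,\gamma^1\cdots\gamma^{2n}$ if $2n-2t\equiv2\bmod4$ (oriented orthonormal frames), and let $\Pi^\pm=\frac12(1\pm\gamma^*)$ be the projections of $S=S^+\oplus S^-$ onto $S^\pm$. For a smooth complex valued $\ell$-form $F$ put $\mathcal A^F_\mu=F_{\nu_1\dots\nu_\ell}\gamma^{\nu_1\dots\nu_\ell}\gamma_\mu\Pi^\pm$ (either sign, fixed). Let $(\ast)$ be the condition: $\ell\equiv3\bmod4$ if $n$ is odd, and $\ell\equiv1+\Delta_0\Delta_1\bmod4$ if $n$ is even. Then: (1) for every $\ell$-form $F$ whose contribution $\mathcal A^F$ does not vanish identically, the connection $D=\nabla+\mathcal A^F$ is admissible if and only if $(\ast)$ holds; (2) for $0\le\ell\le 2n$, the connection $\nabla+\mathcal A^F$ is admissible for all $\ell$-forms $F$ if and only if $(\ast)$ holds. -/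

import Mathlib

open Bundle Set
open scoped Manifold ContDiff Topology

noncomputable section

namespace SpinGeometry

/-! ### Algebraic model: signature, Clifford algebra, spinor module, charge conjugation -/

/-- The diagonal entries `g_{aa}` of the standard metric on `ℝ^{2n}` with `t` time-like
directions: `-1` for the first `t` directions and `+1` for the others. -/
def sgn (n t : ℕ) (a : Fin (2 * n)) : ℝ := if a.val < t then -1 else 1

/-- The quadratic form `v ↦ -g(v,v)` on `ℝ^{2n}`; in its Clifford algebra one has
`v w + w v = -2 g(v,w)`. -/
def cliffordForm (n t : ℕ) : QuadraticForm ℝ (Fin (2 * n) → ℝ) :=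
  QuadraticMap.weightedSumSquares ℝ (fun a => -sgn n t a)

/-- The real Clifford algebra of signature `(t, 2n - t)` with the convention `v² = -g(v,v)`. -/
abbrev Cl (n t : ℕ) : Type := CliffordAlgebra (cliffordForm n t)

/-- The space of (complex) Dirac spinors in dimension `2n`, of complex dimension `2^n`. -/
abbrev Spinor (n : ℕ) : Type := Fin (2 ^ n) → ℂ

/-- A spinor representation: a complex representation of the Clifford algebra on the space of Dirac
spinors. (As the dimension is `2^n`, it is irreducible, and any two of them are equivalent.) -/
abbrev SpinorRep (n t : ℕ) : Type := Cl n t →ₐ[ℝ] Module.End ℂ (Spinor n)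

/-- The Clifford action of a vector of `ℝ^{2n}` on spinors. -/
def SpinorRep.vec {n t : ℕ} (ρ : SpinorRep n t) :
    (Fin (2 * n) → ℝ) →ₗ[ℝ] Module.End ℂ (Spinor n) :=
  ρ.toLinearMap ∘ₗ CliffordAlgebra.ι (cliffordForm n t)

/-- `γ^a = g^{aa} γ_a`, the gamma matrix with upper index in the standard orthonormal basis. -/
def SpinorRep.gammaUp {n t : ℕ} (ρ : SpinorRep n t) (a : Fin (2 * n)) : Module.End ℂ (Spinor n) :=
  sgn n t a • ρ.vec (Pi.single a 1)

/-- `γ^{a₁⋯a_ℓ} = γ^{[a₁} ⋯ γ^{a_ℓ]}`, the skew symmetrised product (with weight `1/ℓ!`). -/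
def SpinorRep.gammaAlt {n t : ℕ} (ρ : SpinorRep n t) {ℓ : ℕ} (a : Fin ℓ → Fin (2 * n)) :
    Module.End ℂ (Spinor n) :=
  ((Nat.factorial ℓ : ℂ)⁻¹) • ∑ σ : Equiv.Perm (Fin ℓ),
    ((Equiv.Perm.sign σ : ℤ) : ℂ) • (List.ofFn fun k => ρ.gammaUp (a (σ k))).prod

/-- The chirality matrix `γ^*`: it is `γ^1 ⋯ γ^{2n}` if the signature `(2n - t) - t` of the metric
is `0` mod `4`, and `i γ^1 ⋯ γ^{2n}` if it is `2` mod `4`. -/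
def SpinorRep.gammaStar {n t : ℕ} (ρ : SpinorRep n t) : Module.End ℂ (Spinor n) :=
  (if ((2 * n : ℤ) - 2 * t) % 4 = 0 then (1 : ℂ) else Complex.I) •
    (List.ofFn fun a => ρ.gammaUp a).prod

/-- The chiral projection `Π^± = (1 ± γ^*) / 2` of `S = S⁺ ⊕ S⁻` onto `S^±`; the sign is given
by a unit of `ℤ`. -/
def SpinorRep.chiralProj {n t : ℕ} (ρ : SpinorRep n t) (ε : ℤˣ) : Module.End ℂ (Spinor n) :=
  (2 : ℂ)⁻¹ • (1 + ((ε : ℤ) : ℂ) • ρ.gammaStar)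

/-- `C` is a charge conjugation on the spinors: a nondegenerate spin-invariant complex bilinear
form such that `C(φ, ψ)` has symmetry `Δ₀ = ±1` and `C(φ, γ_μ ψ)` has symmetry `Δ₁ = ±1`. -/
structure IsChargeConjugation {n t : ℕ} (ρ : SpinorRep n t)
    (C : Spinor n →ₗ[ℂ] Spinor n →ₗ[ℂ] ℂ) (Δ₀ Δ₁ : ℤ) : Prop where
  nondegenerate : ∀ φ, (∀ ψ, C φ ψ = 0) → φ = 0
  spin_invariant : ∀ s ∈ spinGroup (cliffordForm n t), ∀ φ ψ, C (ρ s φ) (ρ s ψ) = C φ ψ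
  sign₀ : Δ₀ = 1 ∨ Δ₀ = -1
  sign₁ : Δ₁ = 1 ∨ Δ₁ = -1
  symm₀ : ∀ φ ψ, C φ ψ = (Δ₀ : ℂ) * C ψ φ
  symm₁ : ∀ v φ ψ, C φ (ρ.vec v ψ) = (Δ₁ : ℂ) * C ψ (ρ.vec v φ)

/-! ### Pseudo-Riemannian metrics and the Levi-Civita connection -/

/-- The model vector space of a `2n`-dimensional manifold. -/
abbrev E (n : ℕ) : Type := EuclideanSpace ℝ (Fin (2 * n))

/-- The model with corners of a `2n`-dimensional manifold without boundary. -/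
abbrev mdl (n : ℕ) : ModelWithCorners ℝ (E n) (E n) := 𝓘(ℝ, E n)

section Manifold

variable {n : ℕ} {M : Type*} [TopologicalSpace M] [ChartedSpace (E n) M]
  [IsManifold (mdl n) ∞ M]

/-- Smoothness of a vector field. -/
def IsSmoothVF (X : (x : M) → TangentSpace (mdl n) x) : Prop :=
  ContMDiff (mdl n) (mdl n).tangent ∞ (fun x => (⟨x, X x⟩ : TangentBundle (mdl n) M))

variable (n M) in
/-- A smooth pseudo-Riemannian metric on a `2n`-dimensional manifold. -/
structure PseudoRiemannianMetric where
  /-- the scalar product on the tangent spaces -/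
  val (x : M) : TangentSpace (mdl n) x →L[ℝ] TangentSpace (mdl n) x →L[ℝ] ℝ
  symm (x : M) (v w : TangentSpace (mdl n) x) : val x v w = val x w v
  nondegenerate (x : M) (v : TangentSpace (mdl n) x) : (∀ w, val x v w = 0) → v = 0
  contMDiff : ContMDiff (mdl n) ((mdl n).prod 𝓘(ℝ, E n →L[ℝ] E n →L[ℝ] ℝ)) ∞
    (fun x : M => TotalSpace.mk' (E n →L[ℝ] E n →L[ℝ] ℝ)
      (E := fun x : M => TangentSpace (mdl n) x →L[ℝ] TangentSpace (mdl n) x →L[ℝ] ℝ) x (val x))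

variable (n M) in
/-- Connections on the tangent bundle. -/
abbrev TangentConnection :=
  CovariantDerivative (mdl n) (E n) (fun x : M => TangentSpace (mdl n) x)

/-- `nab` is the Levi-Civita connection of `g`: the torsion free metric connection on `TM`.
Here `nab Y x (X x)` is `∇_X Y` at `x`. -/
structure IsLeviCivita (g : PseudoRiemannianMetric n M) (nab : TangentConnection n M) : Prop where
  torsion_free : ∀ (X Y : (x : M) → TangentSpace (mdl n) x) (x : M),
    MDifferentiableAt (mdl n) (mdl n).tangent
      (fun y => (⟨y, X y⟩ : TangentBundle (mdl n) M)) x →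
    MDifferentiableAt (mdl n) (mdl n).tangent
      (fun y => (⟨y, Y y⟩ : TangentBundle (mdl n) M)) x →
    nab Y x (X x) - nab X x (Y x) = VectorField.mlieBracket (mdl n) X Y x
  metric : ∀ (Y Z : (x : M) → TangentSpace (mdl n) x) (x : M),
    MDifferentiableAt (mdl n) (mdl n).tangent
      (fun y => (⟨y, Y y⟩ : TangentBundle (mdl n) M)) x →
    MDifferentiableAt (mdl n) (mdl n).tangent
      (fun y => (⟨y, Z y⟩ : TangentBundle (mdl n) M)) x →
    ∀ v : TangentSpace (mdl n) x,
    mvfderiv (mdl n) (fun y => g.val y (Y y) (Z y)) x v =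
      g.val x (nab Y x v) (Z x) + g.val x (Y x) (nab Z x v)

/-! ### Spin structures and the spinor bundle -/

/-- A spin structure on a `2n`-dimensional pseudo-Riemannian manifold with `t` time-like
directions, given by local orthonormal frames over an open cover together with a smooth cocycle
with values in the spin group which lifts the changes of frame. -/
structure SpinStructure (ι : Type*) (t : ℕ) (g : PseudoRiemannianMetric n M) where
  /-- the open sets of the cover -/
  baseSet : ι → Set M
  isOpen_baseSet : ∀ i, IsOpen (baseSet i)
  /-- for every point a member of the cover which contains it -/
  indexAt : M → ι
  mem_baseSet_at : ∀ x, x ∈ baseSet (indexAt x)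
  /-- the local frames; values outside of the base sets are irrelevant -/
  frame : ι → Fin (2 * n) → (x : M) → TangentSpace (mdl n) x
  contMDiffOn_frame : ∀ i a, ContMDiffOn (mdl n) (mdl n).tangent ∞
    (fun x => (⟨x, frame i a x⟩ : TangentBundle (mdl n) M)) (baseSet i)
  orthonormal : ∀ i, ∀ x ∈ baseSet i, ∀ a b,
    g.val x (frame i a x) (frame i b x) = if a = b then sgn n t a else 0
  /-- the cocycle of the spin structure -/
  trans : ι → ι → M → Cl n t
  trans_mem : ∀ i j, ∀ x ∈ baseSet i ∩ baseSet j, trans i j x ∈ spinGroup (cliffordForm n t)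
  trans_self : ∀ i, ∀ x ∈ baseSet i, trans i i x = 1
  trans_comp : ∀ i j k, ∀ x ∈ baseSet i ∩ baseSet j ∩ baseSet k,
    trans j k x * trans i j x = trans i k x
  /-- the cocycle is smooth as a function into the finite dimensional space `Cl n t` -/
  contMDiffOn_trans : ∀ i j (f : Cl n t →ₗ[ℝ] ℝ),
    ContMDiffOn (mdl n) 𝓘(ℝ, ℝ) ∞ (fun x => f (trans i j x)) (baseSet i ∩ baseSet j)
  /-- if a tangent vector has components `v` in the `i`-th and `w` in the `j`-th frame, then `w` is
  the image of `v` under the rotation covered by `trans i j`, i.e. `w = s v s⁻¹` -/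
  trans_covers : ∀ i j, ∀ x ∈ baseSet i ∩ baseSet j, ∀ v w : Fin (2 * n) → ℝ,
    ∑ a, v a • frame i a x = ∑ a, w a • frame j a x →
    trans i j x * CliffordAlgebra.ι (cliffordForm n t) v =
      CliffordAlgebra.ι (cliffordForm n t) w * trans i j x

namespace SpinStructure

variable {ι : Type*} {t : ℕ} {g : PseudoRiemannianMetric n M}

lemma contMDiffOn_coord (s : SpinStructure ι t g) (ρ : SpinorRep n t) (i j : ι) :
    ContMDiffOn (mdl n) 𝓘(ℝ, Spinor n →L[ℝ] Spinor n) ∞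
      (fun x => LinearMap.toContinuousLinearMap ((ρ (s.trans i j x)).restrictScalars ℝ))
      (s.baseSet i ∩ s.baseSet j) := by
  let L : Cl n t →ₗ[ℝ] (Spinor n →L[ℝ] Spinor n) :=
    { toFun := fun c => LinearMap.toContinuousLinearMap ((ρ c).restrictScalars ℝ)
      map_add' := fun a b => by ext v k; simp
      map_smul' := fun a b => by ext v k; simp }
  let b := Module.finBasis ℝ (Spinor n →L[ℝ] Spinor n)
  have h : ∀ c, L c = ∑ k, b.repr (L c) k • b k := fun c => (b.sum_repr (L c)).symm
  have h2 : ContMDiffOn (mdl n) 𝓘(ℝ, Spinor n →L[ℝ] Spinor n) ∞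
      (fun x => ∑ k, b.repr (L (s.trans i j x)) k • b k) (s.baseSet i ∩ s.baseSet j) := by
    refine contMDiffOn_finsetSum fun k _ => ?_
    exact (s.contMDiffOn_trans i j (b.coord k ∘ₗ L)).smul contMDiffOn_const
  exact h2.congr fun x _ => h _

/-- The spinor bundle, associated to the spin structure by the spinor representation. -/
def core (s : SpinStructure ι t g) (ρ : SpinorRep n t) : VectorBundleCore ℝ M (Spinor n) ι where
  baseSet := s.baseSet
  isOpen_baseSet := s.isOpen_baseSet
  indexAt := s.indexAt
  mem_baseSet_at := s.mem_baseSet_at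
  coordChange i j x := LinearMap.toContinuousLinearMap ((ρ (s.trans i j x)).restrictScalars ℝ)
  coordChange_self i x hx v := by simp [s.trans_self i x hx]
  continuousOn_coordChange i j := (s.contMDiffOn_coord ρ i j).continuousOn
  coordChange_comp i j k x hx v := by simp [← s.trans_comp i j k x hx]

instance (s : SpinStructure ι t g) (ρ : SpinorRep n t) : (s.core ρ).IsContMDiff (mdl n) ∞ :=
  ⟨s.contMDiffOn_coord ρ⟩

/-- The fibre `S_x` of the spinor bundle. It is a copy of `Spinor n`, through the trivialisation
with index `s.indexAt x`. -/
abbrev Fib (s : SpinStructure ι t g) (ρ : SpinorRep n t) (x : M) : Type := (s.core ρ).Fiber x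

/-- Smoothness of a section of the spinor bundle. -/
def IsSmoothSection (s : SpinStructure ι t g) (ρ : SpinorRep n t) (ψ : (x : M) → s.Fib ρ x) :
    Prop :=
  ContMDiff (mdl n) ((mdl n).prod 𝓘(ℝ, Spinor n)) ∞
    (fun x => (⟨x, ψ x⟩ : TotalSpace (Spinor n) (s.Fib ρ)))

/-- The components of a tangent vector at `x` in the frame with index `s.indexAt x`. -/
def comp (s : SpinStructure ι t g) (x : M) : TangentSpace (mdl n) x →ₗ[ℝ] (Fin (2 * n) → ℝ) :=
  LinearMap.pi fun a => sgn n t a • (g.val x (s.frame (s.indexAt x) a x)).toLinearMap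

/-- Clifford multiplication `γ : T_x M → End(S_x)`. -/
def gamma (s : SpinStructure ι t g) (ρ : SpinorRep n t) (x : M) :
    TangentSpace (mdl n) x →ₗ[ℝ] Module.End ℂ (Spinor n) :=
  ρ.vec ∘ₗ s.comp x

/-- The Clifford product `X φ = γ(X) φ` of a tangent vector and a spinor at `x`. -/
def cliff (s : SpinStructure ι t g) (ρ : SpinorRep n t) {x : M} (X : TangentSpace (mdl n) x)
    (φ : s.Fib ρ x) : s.Fib ρ x :=
  s.gamma ρ x X φ

/-- The connection one-form of the spin connection at `x` in the spin frame with index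
`s.indexAt x`: `X ↦ ¼ ∑_b γ^b γ(∇_X e_b)`. -/
def spinForm (s : SpinStructure ι t g) (ρ : SpinorRep n t) (nab : TangentConnection n M) (x : M) :
    TangentSpace (mdl n) x →ₗ[ℝ] Module.End ℂ (Spinor n) :=
  (4 : ℝ)⁻¹ • ∑ b, LinearMap.mulLeft ℝ (ρ.gammaUp b) ∘ₗ s.gamma ρ x ∘ₗ
    (nab (s.frame (s.indexAt x) b) x).toLinearMap

/-- The section `ψ` of the spinor bundle, read in the trivialisation with index
`s.indexAt x`. -/
def localRep (s : SpinStructure ι t g) (ρ : SpinorRep n t) (ψ : (x : M) → s.Fib ρ x) (x y : M) :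
    Spinor n :=
  (s.core ρ).coordChange (s.indexAt y) (s.indexAt x) y (ψ y)

instance (s : SpinStructure ι t g) (ρ : SpinorRep n t) (x : M) :
    IsTopologicalAddGroup (s.Fib ρ x) :=
  inferInstanceAs (IsTopologicalAddGroup (Spinor n))

instance (s : SpinStructure ι t g) (ρ : SpinorRep n t) (x : M) :
    ContinuousSMul ℝ (s.Fib ρ x) :=
  inferInstanceAs (ContinuousSMul ℝ (Spinor n))

/-- The one-form `X ↦ B(X) φ` with spinor values, for a spinor `φ`. -/
def applyForm {x : M} (B : TangentSpace (mdl n) x →ₗ[ℝ] Module.End ℂ (Spinor n)) (φ : Spinor n) :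
    TangentSpace (mdl n) x →L[ℝ] Spinor n :=
  (LinearMap.toContinuousLinearMap
    (((LinearMap.applyₗ φ).restrictScalars ℝ ∘ₗ B : TangentSpace (mdl n) x →ₗ[ℝ] Spinor n) :
      E n →ₗ[ℝ] Spinor n) : E n →L[ℝ] Spinor n)

/-- The same one-form, for a spinor at a point of the spinor bundle. -/
def applyFib (s : SpinStructure ι t g) (ρ : SpinorRep n t) {x : M}
    (B : TangentSpace (mdl n) x →ₗ[ℝ] Module.End ℂ (Spinor n)) (φ : s.Fib ρ x) :
    TangentSpace (mdl n) x →L[ℝ] s.Fib ρ x :=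
  applyForm B φ

/-- Connections on the spinor bundle. -/
abbrev SpinorConnection (s : SpinStructure ι t g) (ρ : SpinorRep n t) :=
  CovariantDerivative (mdl n) (Spinor n) (s.Fib ρ)

lemma mdifferentiableAt_localRep (s : SpinStructure ι t g) (ρ : SpinorRep n t)
    {ψ : (x : M) → s.Fib ρ x} {x : M}
    (h : MDifferentiableAt (mdl n) ((mdl n).prod 𝓘(ℝ, Spinor n))
      (fun y => (⟨y, ψ y⟩ : TotalSpace (Spinor n) (s.Fib ρ))) x) :
    MDifferentiableAt (mdl n) 𝓘(ℝ, Spinor n) (s.localRep ρ ψ x) x :=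
  (mdifferentiableAt_section _ ψ).1 h

/-- The Levi-Civita connection on the spinor bundle: in a spin frame
`∇_X ψ = X(ψ) + ¼ ∑_b γ^b γ(∇_X e_b) ψ`. -/
def leviCivita (s : SpinStructure ι t g) (ρ : SpinorRep n t) (nab : TangentConnection n M) :
    s.SpinorConnection ρ where
  toFun ψ x := (mvfderiv (mdl n) (s.localRep ρ ψ x) x + applyForm (s.spinForm ρ nab x) (ψ x) :
    TangentSpace (mdl n) x →L[ℝ] Spinor n)
  isCovariantDerivativeOnUniv :=
    { add := by
        intro σ σ' x hσ hσ' _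
        have e : s.localRep ρ (σ + σ') x = s.localRep ρ σ x + s.localRep ρ σ' x := by
          funext y
          exact map_add ((s.core ρ).coordChange (s.indexAt y) (s.indexAt x) y) (σ y) (σ' y)
        have h := mvfderiv_add (s.mdifferentiableAt_localRep ρ hσ)
          (s.mdifferentiableAt_localRep ρ hσ')
        have h2 : applyForm (s.spinForm ρ nab x) (σ x + σ' x : Spinor n) =
            applyForm (s.spinForm ρ nab x) (σ x) + applyForm (s.spinForm ρ nab x) (σ' x) := by
          ext1 X
          exact map_add (s.spinForm ρ nab x X) (σ x) (σ' x)
        refine (congrArg₂ (· + ·) ((congrArg (fun u => mvfderiv (mdl n) u x) e).trans h) h2).trans ?_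
        exact add_add_add_comm _ _ _ _
      leibniz := by
        intro σ f x hσ hf _
        have e : s.localRep ρ (f • σ) x = f • s.localRep ρ σ x := by
          funext y
          exact map_smul ((s.core ρ).coordChange (s.indexAt y) (s.indexAt x) y) (f y) (σ y)
        have h := mvfderiv_smul hf (s.mdifferentiableAt_localRep ρ hσ)
        have e' : s.localRep ρ σ x x = σ x :=
          (s.core ρ).coordChange_self _ x ((s.core ρ).mem_baseSet_at x) (σ x)
        rw [e'] at h
        have h2 : applyForm (s.spinForm ρ nab x) (f x • σ x : Spinor n) =
            f x • applyForm (s.spinForm ρ nab x) (σ x) := by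
          ext1 X
          exact ((s.spinForm ρ nab x X).restrictScalars ℝ).map_smul (f x) (σ x)
        refine (congrArg₂ (· + ·) ((congrArg (fun u => mvfderiv (mdl n) u x) e).trans h) h2).trans ?_
        ext1 X
        let φ : Spinor n := σ x
        change f x • mvfderiv (mdl n) (s.localRep ρ σ x) x X + mvfderiv (mdl n) f x X • φ +
          f x • applyForm (s.spinForm ρ nab x) φ X =
          f x • (mvfderiv (mdl n) (s.localRep ρ σ x) x X +
            applyForm (s.spinForm ρ nab x) φ X : Spinor n) + mvfderiv (mdl n) f x X • φ
        rw [smul_add]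
        exact add_right_comm _ _ _ }

/-- The connection `D + B` for an `End(S)`-valued one-form `B`. -/
def addForm {s : SpinStructure ι t g} {ρ : SpinorRep n t} (D : s.SpinorConnection ρ)
    (B : (x : M) → TangentSpace (mdl n) x →ₗ[ℝ] Module.End ℂ (Spinor n)) :
    s.SpinorConnection ρ where
  toFun ψ x := D ψ x + s.applyFib ρ (B x) (ψ x)
  isCovariantDerivativeOnUniv :=
    { add := by
        intro σ σ' x hσ hσ' _
        have h2 : s.applyFib ρ (B x) (σ x + σ' x) =
            s.applyFib ρ (B x) (σ x) + s.applyFib ρ (B x) (σ' x) := by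
          ext1 X
          exact map_add (B x X) (σ x) (σ' x)
        rw [D.isCovariantDerivativeOnUniv.add hσ hσ', Pi.add_apply, h2]
        exact add_add_add_comm _ _ _ _
      leibniz := by
        intro σ f x hσ hf _
        have h2 : s.applyFib ρ (B x) (f x • σ x) = f x • s.applyFib ρ (B x) (σ x) := by
          ext1 X
          exact ((B x X).restrictScalars ℝ).map_smul (f x) (σ x)
        rw [D.isCovariantDerivativeOnUniv.leibniz hσ hf, Pi.smul_apply', h2, smul_add]
        exact add_right_comm _ _ _ }

/-! ### Admissible connections -/

/-- `D'` is the connection `D^C` associated to `D`: the connection `D ⊗ 1 + 1 ⊗ D'` makes the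
charge conjugation parallel, i.e. `X(C(φ, ψ)) = C(D_X φ, ψ) + C(φ, D'_X ψ)`. (As `C` is
nondegenerate, this determines `D'` on smooth sections.) -/
def IsConjugate {s : SpinStructure ι t g} {ρ : SpinorRep n t}
    (C : Spinor n →ₗ[ℂ] Spinor n →ₗ[ℂ] ℂ) (D D' : s.SpinorConnection ρ) : Prop :=
  ∀ φ ψ : (x : M) → s.Fib ρ x, s.IsSmoothSection ρ φ → s.IsSmoothSection ρ ψ →
    ∀ (x : M) (X : TangentSpace (mdl n) x),
      mvfderiv (mdl n) (fun y => C (φ y) (ψ y)) x X = C (D φ x X) (ψ x) + C (φ x) (D' ψ x X)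

/-- `(\hat D_Z γ)(X) ξ = D_Z(γ(X) ξ) - γ(∇_Z X) ξ - γ(X) D^C_Z ξ`, where `D'` stands for
`D^C`. -/
def hatGamma {s : SpinStructure ι t g} {ρ : SpinorRep n t} (nab : TangentConnection n M)
    (D D' : s.SpinorConnection ρ) (Z X : (x : M) → TangentSpace (mdl n) x)
    (ξ : (x : M) → s.Fib ρ x) (x : M) : s.Fib ρ x :=
  D (fun y => s.cliff ρ (X y) (ξ y)) x (Z x) - s.cliff ρ (nab X x (Z x)) (ξ x) -
    s.cliff ρ (X x) (D' ξ x (Z x))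

/-- A connection `D` on the spinor bundle is admissible if `\hat D γ` is skew symmetric. -/
def IsAdmissible {s : SpinStructure ι t g} {ρ : SpinorRep n t} (nab : TangentConnection n M)
    (C : Spinor n →ₗ[ℂ] Spinor n →ₗ[ℂ] ℂ) (D : s.SpinorConnection ρ) : Prop :=
  ∃ D' : s.SpinorConnection ρ, IsConjugate C D D' ∧
    ∀ (Z X : (x : M) → TangentSpace (mdl n) x) (ξ : (x : M) → s.Fib ρ x),
      IsSmoothVF Z → IsSmoothVF X → s.IsSmoothSection ρ ξ →
      ∀ x, hatGamma nab D D' Z X ξ x = -hatGamma nab D D' X Z ξ x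

/-! ### The contribution of an `ℓ`-form -/

/-- The endomorphism `F_{a₁⋯a_ℓ} γ^{a₁⋯a_ℓ}` of `S_x`, for an `ℓ`-form `F` at `x`. -/
def formGamma (s : SpinStructure ι t g) (ρ : SpinorRep n t) {ℓ : ℕ} (x : M)
    (F : TangentSpace (mdl n) x [⋀^Fin ℓ]→ₗ[ℝ] ℂ) : Module.End ℂ (Spinor n) :=
  ∑ a : Fin ℓ → Fin (2 * n), F (fun k => s.frame (s.indexAt x) (a k) x) • ρ.gammaAlt a

/-- The `End(S)`-valued one-form `A_μ = F_{a₁⋯a_ℓ} γ^{a₁⋯a_ℓ} γ_μ Π^ε` defined by an `ℓ`-form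
`F`. -/
def contribution (s : SpinStructure ι t g) (ρ : SpinorRep n t) (ε : ℤˣ) {ℓ : ℕ}
    (F : (x : M) → TangentSpace (mdl n) x [⋀^Fin ℓ]→ₗ[ℝ] ℂ) (x : M) :
    TangentSpace (mdl n) x →ₗ[ℝ] Module.End ℂ (Spinor n) :=
  LinearMap.mulLeft ℝ (s.formGamma ρ x (F x)) ∘ₗ LinearMap.mulRight ℝ (ρ.chiralProj ε) ∘ₗ
    s.gamma ρ x

end SpinStructure

/-- Smoothness of a (complex valued) `ℓ`-form. -/
def IsSmoothForm {ℓ : ℕ} (F : (x : M) → TangentSpace (mdl n) x [⋀^Fin ℓ]→ₗ[ℝ] ℂ) : Prop :=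
  ∀ X : Fin ℓ → (x : M) → TangentSpace (mdl n) x, (∀ k, IsSmoothVF (X k)) →
    ContMDiff (mdl n) 𝓘(ℝ, ℂ) ∞ (fun x => F x (fun k => X k x))

end Manifold

end SpinGeometry

end

/-! Write `d = Δ₀Δ₁`, `S = F_{a₁⋯a_ℓ} γ^{a₁⋯a_ℓ}`, and `B*` for the adjoint of an endomorphism `B`
with respect to `C`. The Levi-Civita connection on spinors is compatible with `γ`
(`leviCivita_cliff`) and makes `C` parallel (`mvfderiv_chargeConjugation`). Hence for `D = ∇ + A`
the conjugate connection is `∇ - A*`, all derivatives cancel in `\hat D γ`, and admissibility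
becomes the pointwise algebraic condition that `A_Z γ(X) + γ(X) A*_Z` be skew in `Z, X`
(`isAdmissible_addForm_iff`).

The adjoints are explicit: `γ_a* = d γ_a`, `S* = d^ℓ (-1)^{ℓ(ℓ-1)/2} S`, and `Π^ε* = Π^{ε(-1)^n}`.
For `A_Z = S γ_Z Π^ε`, moving the projections past one gamma matrix lets the Clifford relation
collapse the symmetrised expression to `-2 g(Z,X)` times `S Π^{-ε} + c Π^{-ε(-1)^n} S`, where `c =
d^{ℓ+1} (-1)^{ℓ(ℓ-1)/2}`. A non-null vector shows that this `obstruction` itself must vanish.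

Since `S` is a combination of products of `ℓ` gamma matrices, the second term is `c S
Π^{-ε(-1)^{n+ℓ}}`. If `n + ℓ` is even, the obstruction is `(1 + c) S Π^{-ε}`, and `c = -1` is
exactly condition (∗). If `n + ℓ` is odd, (∗) fails and the obstruction vanishes only when `S Π^{-ε}
= 0` (`obstruction_eq_zero_iff`). As `A_Z = S Π^{-ε} γ_Z`, a nonzero contribution has `S Π^{-ε} ≠ 0`
somewhere, which gives (1). For (2), a cut-off wedge product of frame covectors supplies a smooth
form with `S` invertible at a point, while `Π^{-ε} ≠ 0`. -/

noncomputable section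

namespace SpinGeometry

/-! ### Products of anticommuting elements -/

section Anticommuting

variable {R α : Type*} [Ring R]

lemma mul_prod_map_of_anticommute {f : α → R} {x : R} {l : List α}
    (h : ∀ a ∈ l, x * f a = -(f a * x)) :
    x * (l.map f).prod = (-1) ^ l.length * ((l.map f).prod * x) := by
  induction l with
  | nil => simp
  | cons a l ih =>
    have ih := ih fun b hb => h b (List.mem_cons_of_mem _ hb)
    simp only [List.map_cons, List.prod_cons, List.length_cons]
    rw [← mul_assoc, h a List.mem_cons_self, neg_mul, mul_assoc, ih, pow_succ]
    have := (Commute.neg_one_left (f a)).pow_left l.length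
    simp only [← mul_assoc, ← this.eq]
    simp [mul_assoc]

/-- `f b` anticommutes with every factor except itself, so the sign is that of `length - 1`; the
exponent `length + 1` has the same parity and avoids truncated subtraction. -/
lemma mul_prod_map_of_mem [DecidableEq α] {f : α → R}
    (h : ∀ a b, a ≠ b → f a * f b = -(f b * f a))
    {l : List α} (hl : l.Nodup) {b : α} (hb : b ∈ l) :
    f b * (l.map f).prod = (-1) ^ (l.length + 1) * ((l.map f).prod * f b) := by
  induction l with
  | nil => simp at hb
  | cons a l ih =>
    simp only [List.map_cons, List.prod_cons, List.length_cons]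
    have hc := (Commute.neg_one_left (f a)).pow_left l.length
    by_cases hab : b = a
    · subst hab
      conv_lhs => rw [mul_prod_map_of_anticommute (f := f) (x := f b) (l := l)
        fun a ha => h b a fun e => (List.nodup_cons.1 hl).1 (e ▸ ha)]
      rw [← mul_assoc, ← hc.eq]
      simp [pow_succ, mul_assoc]
    · have hbl : b ∈ l := (List.mem_cons.1 hb).resolve_left hab
      rw [← mul_assoc, h b a hab, neg_mul, mul_assoc, ih (List.nodup_cons.1 hl).2 hbl,
        pow_succ, pow_succ, pow_succ]
      simp only [← mul_assoc, mul_neg, neg_mul, mul_one, neg_neg, ← hc.eq]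

lemma mul_prod_map_of_mem_of_even [DecidableEq α] {f : α → R}
    (h : ∀ a b, a ≠ b → f a * f b = -(f b * f a))
    {l : List α} (hl : l.Nodup) {b : α} (hb : b ∈ l) (he : Even l.length) :
    f b * (l.map f).prod = -((l.map f).prod * f b) := by
  rw [mul_prod_map_of_mem h hl hb, he.add_one.neg_one_pow, neg_one_mul]

/-- Reversal exchanges each of the `length.choose 2` pairs of distinct factors once. -/
lemma prod_map_reverse_of_anticommute {f : α → R}
    (h : ∀ a b, a ≠ b → f a * f b = -(f b * f a)) {l : List α} (hl : l.Nodup) :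
    (l.reverse.map f).prod = (-1) ^ (l.length.choose 2) * (l.map f).prod := by
  induction l with
  | nil => simp
  | cons a l ih =>
    have hn := List.nodup_cons.1 hl
    have h1 := mul_prod_map_of_anticommute (f := f) (x := f a) (l := l)
      fun b hb => h a b fun e => hn.1 (e ▸ hb)
    rw [List.reverse_cons, List.map_append, List.prod_append, ih hn.2]
    simp only [List.map_cons, List.map_nil, List.prod_cons, List.prod_nil, mul_one,
      List.length_cons]
    rw [h1, Nat.choose_succ_succ', Nat.choose_one_right, pow_add]
    rcases neg_one_pow_eq_or R l.length with e | e <;> rw [e] <;> simp [mul_assoc]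

/-- The product collapses from the middle outwards: each innermost pair is a square, hence central.
-/
lemma prod_mul_prod_reverse {f : α → R} {c : α → R} (hc : ∀ a, c a ∈ Set.center R)
    (h : ∀ a, f a * f a = c a) (l : List α) :
    (l.map f).prod * (l.reverse.map f).prod = (l.map c).prod := by
  induction l with
  | nil => simp
  | cons a l ih =>
    simp only [List.reverse_cons, List.map_append, List.prod_append, List.map_cons, List.map_nil,
      List.prod_cons, List.prod_nil, mul_one]
    have hcen : Commute (l.map c).prod (f a) := by
      have : (l.map c).prod ∈ Submonoid.center R := by
        refine Submonoid.list_prod_mem _ fun x hx => ?_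
        obtain ⟨b, -, rfl⟩ := List.mem_map.1 hx
        exact hc b
      exact (Submonoid.mem_center_iff.1 this (f a)).symm
    calc f a * (l.map f).prod * ((l.reverse.map f).prod * f a)
        = f a * ((l.map f).prod * (l.reverse.map f).prod) * f a := by simp only [mul_assoc]
      _ = c a * (l.map c).prod := by rw [ih, mul_assoc, hcen.eq, ← mul_assoc, h]

lemma prod_ofFn_comp_swap : ∀ (m : ℕ) (f : Fin (m + 1) → R)
    (_ : ∀ i j, i ≠ j → f i * f j = -(f j * f i)) (i : Fin m),
    (List.ofFn (f ∘ Equiv.swap i.castSucc i.succ)).prod = -(List.ofFn f).prod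
  | 0, _, _, i => i.elim0
  | m + 1, f, h, i => by
    refine Fin.cases ?_ (fun j => ?_) i
    · rw [List.ofFn_succ, List.ofFn_succ, List.ofFn_succ (f := f), List.ofFn_succ]
      have e : (fun k : Fin m => (f ∘ Equiv.swap (Fin.castSucc 0) (Fin.succ 0)) k.succ.succ) =
          fun k => f k.succ.succ := by
        funext k
        simp only [Function.comp_apply]
        rw [Equiv.swap_apply_of_ne_of_ne]
        · exact Fin.succ_ne_zero _
        · exact fun e => Fin.succ_ne_zero _ (Fin.succ_injective _ e)
      rw [e]
      simp only [Function.comp_apply, List.prod_cons, Fin.castSucc_zero, Equiv.swap_apply_left,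
        Equiv.swap_apply_right, ← mul_assoc]
      rw [h (Fin.succ 0) 0 (Fin.succ_ne_zero _), neg_mul]
    · rw [List.ofFn_succ, List.ofFn_succ (f := f), List.prod_cons, List.prod_cons]
      have e : (fun k : Fin (m + 1) => (f ∘ Equiv.swap j.succ.castSucc j.succ.succ) k.succ) =
          (fun k => f k.succ) ∘ Equiv.swap j.castSucc j.succ := by
        funext k
        simp only [Function.comp_apply, Fin.castSucc_succ]
        rw [(Fin.succ_injective _).swap_apply]
      rw [e, prod_ofFn_comp_swap m _ (fun i j hij => h _ _ fun e => hij (Fin.succ_injective _ e)) j,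
        Function.comp_apply, Equiv.swap_apply_of_ne_of_ne, mul_neg]
      · simp [Fin.ext_iff]
      · simp [Fin.ext_iff]

/-- Adjacent transpositions generate the symmetric group, and each of them exchanges two
neighbouring anticommuting factors. -/
lemma prod_ofFn_comp_perm {m : ℕ} (σ : Equiv.Perm (Fin m)) (f : Fin m → R)
    (h : ∀ i j, i ≠ j → f i * f j = -(f j * f i)) :
    (List.ofFn (f ∘ σ)).prod = (Equiv.Perm.sign σ : ℤ) • (List.ofFn f).prod := by
  cases m with
  | zero => simp [Subsingleton.elim σ 1]
  | succ m =>
    have hσ : σ ∈ Submonoid.closure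
        (Set.range fun i : Fin m => Equiv.swap i.castSucc i.succ) := by
      rw [Equiv.Perm.mclosure_swap_castSucc_succ]; trivial
    induction hσ using Submonoid.closure_induction generalizing f with
    | mem x hx =>
      obtain ⟨i, rfl⟩ := hx
      rw [prod_ofFn_comp_swap m f h i, Equiv.Perm.sign_swap (Fin.castSucc_lt_succ).ne]
      simp
    | one => simp
    | mul x y _ _ hx hy =>
      rw [Equiv.Perm.coe_mul, ← Function.comp_assoc,
        hy (f ∘ x) fun i j hij => h _ _ fun e => hij (x.injective e), hx f h, smul_smul, map_mul,
        mul_comm, Units.val_mul]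

end Anticommuting

/-! ### Adjoints with respect to a bilinear form -/

section Adjoint

variable {V : Type*} [AddCommGroup V] [Module ℂ V] {C : V →ₗ[ℂ] V →ₗ[ℂ] ℂ}

/-- `B` is the (right) adjoint of `A` with respect to the bilinear form `C`. -/
def IsAdj (C : V →ₗ[ℂ] V →ₗ[ℂ] ℂ) (A B : Module.End ℂ V) : Prop :=
  ∀ φ ψ, C (A φ) ψ = C φ (B ψ)

lemma IsAdj.one : IsAdj C 1 1 := fun _ _ => rfl

lemma IsAdj.mul {A A' B B' : Module.End ℂ V} (h : IsAdj C A B) (h' : IsAdj C A' B') :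
    IsAdj C (A * A') (B' * B) := fun φ ψ => by
  simp only [Module.End.mul_apply, h _ _, h' _ _]

lemma IsAdj.add {A A' B B' : Module.End ℂ V} (h : IsAdj C A B) (h' : IsAdj C A' B') :
    IsAdj C (A + A') (B + B') := fun φ ψ => by
  simp [h _ _, h' _ _]

lemma IsAdj.smul {A B : Module.End ℂ V} (c : ℂ) (h : IsAdj C A B) :
    IsAdj C (c • A) (c • B) := fun φ ψ => by
  simp [h _ _]

lemma IsAdj.real_smul {A B : Module.End ℂ V} (c : ℝ) (h : IsAdj C A B) :
    IsAdj C (c • A) (c • B) := by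
  have := h.smul (c : ℂ)
  simpa using this

lemma IsAdj.sum {κ : Type*} {s : Finset κ} {A B : κ → Module.End ℂ V}
    (h : ∀ k ∈ s, IsAdj C (A k) (B k)) : IsAdj C (∑ k ∈ s, A k) (∑ k ∈ s, B k) := fun φ ψ => by
  simp only [LinearMap.sum_apply, map_sum]
  exact Finset.sum_congr rfl fun k hk => h k hk φ ψ

lemma IsAdj.list_prod {κ : Type*} {A : κ → Module.End ℂ V} {d : ℂ}
    (h : ∀ k, IsAdj C (A k) (d • A k)) (l : List κ) :
    IsAdj C (l.map A).prod (d ^ l.length • (l.reverse.map A).prod) := by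
  induction l with
  | nil => simpa using IsAdj.one
  | cons a l ih =>
    have := (h a).mul ih
    simp only [List.map_cons, List.prod_cons, List.length_cons, List.reverse_cons, List.map_append,
      List.prod_append, List.map_nil, List.prod_nil, mul_one]
    rw [smul_mul_smul_comm, ← pow_succ] at this
    exact this

end Adjoint

/-! ### Gamma matrices -/

section Gamma

variable {n t : ℕ}

lemma sgn_mul_self (a : Fin (2 * n)) : sgn n t a * sgn n t a = 1 := by
  unfold sgn; split_ifs <;> norm_num

lemma sgn_ne_zero (a : Fin (2 * n)) : sgn n t a ≠ 0 := by
  unfold sgn; split_ifs <;> norm_num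

lemma prod_sgn (ht : t ≤ 2 * n) : ∏ a, sgn n t a = (-1) ^ t := by
  unfold sgn
  rw [Fin.prod_univ_eq_prod_range (fun k => if k < t then (-1 : ℝ) else 1) (2 * n),
    Finset.prod_ite, Finset.prod_const, Finset.prod_const_one, mul_one]
  congr 1
  have : (Finset.range (2 * n)).filter (· < t) = Finset.range t := by
    ext k; simp; omega
  rw [this, Finset.card_range]

/-- The standard scalar product on `ℝ^{2n}` with `t` time-like directions. -/
def minkowski (n t : ℕ) (v w : Fin (2 * n) → ℝ) : ℝ := ∑ a, sgn n t a * (v a * w a)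

lemma neg_one_pow_eq_smul {A : Type*} [Ring A] [Algebra ℂ A] (m : ℕ) :
    (-1 : A) ^ m = (-1 : ℂ) ^ m • 1 := by
  rcases Nat.even_or_odd m with k | k <;> simp [k.neg_one_pow]

lemma neg_one_pow_choose_two_mul {R : Type*} [Ring R] (n : ℕ) :
    (-1 : R) ^ (2 * n).choose 2 = (-1) ^ n := by
  have : (2 * n).choose 2 = n * (2 * n - 1) := by
    rw [Nat.choose_two_right, mul_assoc, Nat.mul_div_cancel_left _ two_pos]
  rw [this]
  cases n with
  | zero => rfl
  | succ n =>
    rw [show 2 * (n + 1) - 1 = 2 * n + 1 by omega, mul_add, pow_add, mul_one,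
      Even.neg_one_pow ⟨(n + 1) * n, by ring⟩, one_mul]

lemma polar_cliffordForm (v w : Fin (2 * n) → ℝ) :
    QuadraticMap.polar (cliffordForm n t) v w = -2 * minkowski n t v w := by
  simp only [QuadraticMap.polar, cliffordForm, QuadraticMap.weightedSumSquares_apply, minkowski,
    Finset.mul_sum, ← Finset.sum_sub_distrib, smul_eq_mul, Pi.add_apply]
  exact Finset.sum_congr rfl fun a _ => by ring

lemma minkowski_single (a b : Fin (2 * n)) :
    minkowski n t (Pi.single a 1) (Pi.single b 1) = if a = b then sgn n t a else 0 := by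
  simp [minkowski, Pi.single_apply, eq_comm]
  aesop

namespace SpinorRep

variable (ρ : SpinorRep n t)

lemma vec_mul_vec_add (v w : Fin (2 * n) → ℝ) :
    ρ.vec v * ρ.vec w + ρ.vec w * ρ.vec v = (-2 * minkowski n t v w) • 1 := by
  have h := congrArg ρ (CliffordAlgebra.ι_mul_ι_add_swap (Q := cliffordForm n t) v w)
  rw [polar_cliffordForm, map_add, map_mul, map_mul, AlgHom.commutes, Algebra.algebraMap_eq_smul_one]
    at h
  exact h

lemma vec_mul_self (v : Fin (2 * n) → ℝ) :
    ρ.vec v * ρ.vec v = (-minkowski n t v v) • 1 := by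
  have h := ρ.vec_mul_vec_add v v
  rw [← two_smul ℝ, neg_mul, ← mul_neg, mul_smul] at h
  exact smul_right_injective _ (two_ne_zero (α := ℝ)) h

lemma gammaUp_anticomm {a b : Fin (2 * n)} (h : a ≠ b) :
    ρ.gammaUp a * ρ.gammaUp b = -(ρ.gammaUp b * ρ.gammaUp a) := by
  have := ρ.vec_mul_vec_add (Pi.single a 1) (Pi.single b 1)
  rw [minkowski_single, if_neg h, mul_zero, zero_smul] at this
  simp only [gammaUp, smul_mul_smul_comm]
  rw [eq_neg_of_add_eq_zero_left this, mul_comm, smul_neg]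

lemma gammaUp_mul_self (a : Fin (2 * n)) : ρ.gammaUp a * ρ.gammaUp a = (-sgn n t a) • 1 := by
  simp only [gammaUp, smul_mul_smul_comm]
  rw [vec_mul_self, minkowski_single, if_pos rfl, sgn_mul_self, one_smul]

lemma vec_eq_sum (v : Fin (2 * n) → ℝ) :
    ρ.vec v = ∑ a, (sgn n t a * v a) • ρ.gammaUp a := by
  conv_lhs => rw [pi_eq_sum_univ' v, map_sum]
  refine Finset.sum_congr rfl fun a _ => ?_
  rw [map_smul, gammaUp, smul_smul, mul_right_comm, sgn_mul_self, one_mul]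

/-- The product of the gamma matrices with indices `a`. -/
def gammaProd {ℓ : ℕ} (a : Fin ℓ → Fin (2 * n)) : Module.End ℂ (Spinor n) :=
  (List.ofFn fun k => ρ.gammaUp (a k)).prod

lemma gammaProd_eq {ℓ : ℕ} (a : Fin ℓ → Fin (2 * n)) :
    ρ.gammaProd a = ((List.ofFn a).map ρ.gammaUp).prod := by
  rw [gammaProd, List.map_ofFn]; rfl

lemma gammaProd_comp_perm {ℓ : ℕ} {a : Fin ℓ → Fin (2 * n)} (ha : Function.Injective a)
    (σ : Equiv.Perm (Fin ℓ)) :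
    ρ.gammaProd (a ∘ σ) = (Equiv.Perm.sign σ : ℤ) • ρ.gammaProd a :=
  prod_ofFn_comp_perm σ (fun k => ρ.gammaUp (a k)) fun _ _ hij =>
    ρ.gammaUp_anticomm fun e => hij (ha e)

lemma isUnit_gammaUp (a : Fin (2 * n)) : IsUnit (ρ.gammaUp a) := by
  have h : ρ.gammaUp a * ((-sgn n t a) • ρ.gammaUp a) = 1 := by
    rw [mul_smul_comm, gammaUp_mul_self, smul_smul, neg_mul_neg, sgn_mul_self, one_smul]
  have h' : ((-sgn n t a) • ρ.gammaUp a) * ρ.gammaUp a = 1 := by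
    rw [smul_mul_assoc, gammaUp_mul_self, smul_smul, neg_mul_neg, sgn_mul_self, one_smul]
  exact ⟨⟨_, _, h, h'⟩, rfl⟩

lemma isUnit_gammaProd {ℓ : ℕ} (a : Fin ℓ → Fin (2 * n)) : IsUnit (ρ.gammaProd a) := by
  rw [gammaProd_eq]
  generalize List.ofFn a = l
  induction l with
  | nil => simp
  | cons b l ih => simpa using (ρ.isUnit_gammaUp b).mul ih

lemma gammaStar_eq : ρ.gammaStar =
    (if ((2 * n : ℤ) - 2 * t) % 4 = 0 then (1 : ℂ) else Complex.I) •
      ((List.finRange (2 * n)).map ρ.gammaUp).prod := by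
  rw [gammaStar, List.ofFn_eq_map]

/-- With `P` the full product, `P` times its reversal is the product of the squares `-sgn`, that is
`(-1)^t`, and the reversal is `(-1)^n P`. -/
lemma prod_gammaUp_mul_self (ht : t ≤ 2 * n) :
    ((List.finRange (2 * n)).map ρ.gammaUp).prod * ((List.finRange (2 * n)).map ρ.gammaUp).prod =
      ((-1 : ℂ) ^ (n + t)) • 1 := by
  have hr := prod_map_reverse_of_anticommute (f := ρ.gammaUp)
    (fun a b h => ρ.gammaUp_anticomm h) (List.nodup_finRange (2 * n))
  have hp := prod_mul_prod_reverse (f := ρ.gammaUp)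
    (c := fun a => algebraMap ℝ (Module.End ℂ (Spinor n)) (-sgn n t a))
    (fun a => Subring.mem_center_iff.2 fun g => (Algebra.commutes _ g).symm)
    (fun a => by rw [gammaUp_mul_self, Algebra.algebraMap_eq_smul_one]) (List.finRange (2 * n))
  have hc : ((List.finRange (2 * n)).map fun a =>
      algebraMap ℝ (Module.End ℂ (Spinor n)) (-sgn n t a)).prod = (-1) ^ t := by
    have e : (List.finRange (2 * n)).map (fun a =>
        algebraMap ℝ (Module.End ℂ (Spinor n)) (-sgn n t a)) =
        ((List.finRange (2 * n)).map fun a => -sgn n t a).map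
          (algebraMap ℝ (Module.End ℂ (Spinor n))) := by simp
    rw [e, ← map_list_prod, ← List.ofFn_eq_map, List.prod_ofFn, Finset.prod_neg, prod_sgn ht]
    simp
  rw [hr, hc, List.length_finRange, neg_one_pow_choose_two_mul] at hp
  have h := congrArg ((-1) ^ n * ·) hp
  have hs : ((-1 : ℂ) ^ (n + t)) • (1 : Module.End ℂ (Spinor n)) = (-1) ^ n * (-1) ^ t := by
    rw [← pow_add]
    exact (neg_one_pow_eq_smul _).symm
  rw [hs, ← h]
  rcases neg_one_pow_eq_or (Module.End ℂ (Spinor n)) n with k | k <;> simp [k]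

lemma gammaStar_mul_self (ht : t ≤ 2 * n) : ρ.gammaStar * ρ.gammaStar = 1 := by
  rw [gammaStar_eq, smul_mul_smul_comm, prod_gammaUp_mul_self ρ ht, smul_smul]
  -- `2n - 2t` is divisible by 4 exactly when `n + t` is even; otherwise `I² = -1` compensates the
  -- sign.
  split_ifs with h
  · rw [Even.neg_one_pow (by grind)]; simp
  · rw [Odd.neg_one_pow (by grind)]; simp

/-- The sign is `-1` because the number of gamma matrices in the product is even. -/
lemma gammaUp_mul_gammaStar (a : Fin (2 * n)) :
    ρ.gammaUp a * ρ.gammaStar = -(ρ.gammaStar * ρ.gammaUp a) := by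
  rw [gammaStar_eq, mul_smul_comm, smul_mul_assoc,
    mul_prod_map_of_mem_of_even (fun a b h => ρ.gammaUp_anticomm h) (List.nodup_finRange (2 * n))
      (List.mem_finRange a) (by simp), smul_neg]

lemma vec_mul_gammaStar (v : Fin (2 * n) → ℝ) :
    ρ.vec v * ρ.gammaStar = -(ρ.gammaStar * ρ.vec v) := by
  rw [vec_eq_sum, Finset.sum_mul, Finset.mul_sum, ← Finset.sum_neg_distrib]
  refine Finset.sum_congr rfl fun a _ => ?_
  rw [smul_mul_assoc, gammaUp_mul_gammaStar, mul_smul_comm, smul_neg]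

lemma vec_mul_chiralProj (ε : ℤˣ) (v : Fin (2 * n) → ℝ) :
    ρ.vec v * ρ.chiralProj ε = ρ.chiralProj (-ε) * ρ.vec v := by
  simp only [chiralProj, mul_smul_comm, smul_mul_assoc, mul_add, add_mul, mul_one, one_mul,
    vec_mul_gammaStar, Units.val_neg, Int.cast_neg]
  module

lemma gammaUp_mul_chiralProj (ε : ℤˣ) (a : Fin (2 * n)) :
    ρ.gammaUp a * ρ.chiralProj ε = ρ.chiralProj (-ε) * ρ.gammaUp a := by
  rw [gammaUp, smul_mul_assoc, vec_mul_chiralProj, mul_smul_comm]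

lemma gammaProd_mul_chiralProj (ε : ℤˣ) {ℓ : ℕ} (a : Fin ℓ → Fin (2 * n)) :
    ρ.gammaProd a * ρ.chiralProj ε = ρ.chiralProj (ε * (-1) ^ ℓ) * ρ.gammaProd a := by
  have h : ∀ l : List (Fin (2 * n)), (l.map ρ.gammaUp).prod * ρ.chiralProj ε =
      ρ.chiralProj (ε * (-1) ^ l.length) * (l.map ρ.gammaUp).prod := by
    intro l
    induction l with
    | nil => simp
    | cons b l ih =>
      rw [List.map_cons, List.prod_cons, mul_assoc, ih, ← mul_assoc, gammaUp_mul_chiralProj,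
        mul_assoc, List.length_cons, pow_succ]
      simp
  rw [gammaProd_eq, h, List.length_ofFn]

lemma chiralProj_mul_self (ht : t ≤ 2 * n) (ε : ℤˣ) :
    ρ.chiralProj ε * ρ.chiralProj ε = ρ.chiralProj ε := by
  have hε : (((ε : ℤ) : ℂ)) * ((ε : ℤ) : ℂ) = 1 := by
    rcases Int.units_eq_one_or ε with rfl | rfl <;> simp
  simp only [chiralProj, smul_mul_smul_comm, mul_add, add_mul, mul_one, one_mul,
    ρ.gammaStar_mul_self ht, hε, one_smul]
  module

lemma chiralProj_add_neg (ε : ℤˣ) : ρ.chiralProj ε + ρ.chiralProj (-ε) = 1 := by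
  simp only [chiralProj, Units.val_neg, Int.cast_neg]
  module

lemma chiralProj_mul_neg (ht : t ≤ 2 * n) (ε : ℤˣ) :
    ρ.chiralProj ε * ρ.chiralProj (-ε) = 0 := by
  have := congrArg (ρ.chiralProj ε * ·) (ρ.chiralProj_add_neg ε)
  simpa [mul_add, ρ.chiralProj_mul_self ht] using this

/-- An invertible gamma matrix intertwines the two projections, so if one vanished both would, yet
they sum to `1`. -/
lemma chiralProj_ne_zero (hn : 1 ≤ n) (ε : ℤˣ) : ρ.chiralProj ε ≠ 0 := by
  intro h
  let a : Fin (2 * n) := ⟨0, by omega⟩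
  have h1 : ρ.chiralProj (-ε) * ρ.gammaUp a = 0 := by
    rw [← gammaUp_mul_chiralProj, h, mul_zero]
  have h2 : ρ.chiralProj (-ε) = 0 := by
    obtain ⟨u, hu⟩ := ρ.isUnit_gammaUp a
    rw [← hu] at h1
    simpa using h1
  have h3 := ρ.chiralProj_add_neg ε
  rw [h, h2, add_zero] at h3
  exact zero_ne_one h3

end SpinorRep
end Gamma

/-! ### Adjoints of gamma products under a charge conjugation, and the algebraic obstruction -/

section Gamma

variable {n t : ℕ}

namespace SpinorRep

variable (ρ : SpinorRep n t)

/-- Contraction of the coefficients of a form with skew symmetrised products of gamma matrices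
agrees with the contraction with plain products. -/
lemma sum_smul_gammaAlt {ℓ : ℕ} {f : (Fin ℓ → Fin (2 * n)) → ℂ}
    (hf : ∀ a (σ : Equiv.Perm (Fin ℓ)), f (a ∘ σ) = ((Equiv.Perm.sign σ : ℤ) : ℂ) * f a) :
    ∑ a, f a • ρ.gammaAlt a = ∑ a, f a • ρ.gammaProd a := by
  -- Reindexing by `σ` produces the sign of `σ` from `f`, which cancels the sign in the skew
  -- symmetrisation; the `ℓ!` equal sums then absorb `1/ℓ!`.
  have key : ∀ σ : Equiv.Perm (Fin ℓ),
      ∑ a, f a • ((Equiv.Perm.sign σ : ℤ) : ℂ) • ρ.gammaProd (a ∘ σ) =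
        ∑ a, f a • ρ.gammaProd a := by
    intro σ
    rw [← Equiv.sum_comp (Equiv.arrowCongr σ.symm (Equiv.refl (Fin (2 * n))))
      fun a => f a • ρ.gammaProd a]
    refine Finset.sum_congr rfl fun a _ => ?_
    have : Equiv.arrowCongr σ.symm (Equiv.refl (Fin (2 * n))) a = a ∘ σ := rfl
    rw [this, hf, smul_smul, mul_comm]
  have h : ∀ a, f a • ρ.gammaAlt a = ((Nat.factorial ℓ : ℂ)⁻¹) • ∑ σ : Equiv.Perm (Fin ℓ),
      f a • ((Equiv.Perm.sign σ : ℤ) : ℂ) • ρ.gammaProd (a ∘ σ) := by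
    intro a
    rw [gammaAlt, smul_comm, Finset.smul_sum]
    rfl
  simp only [h]
  rw [← Finset.smul_sum, Finset.sum_comm, Finset.sum_congr rfl fun σ _ => key σ, Finset.sum_const,
    Finset.card_univ, Fintype.card_perm, Fintype.card_fin, ← Nat.cast_smul_eq_nsmul ℂ, smul_smul,
    inv_mul_cancel₀ (Nat.cast_ne_zero.2 (Nat.factorial_ne_zero ℓ)), one_smul]

end SpinorRep

namespace IsChargeConjugation

variable {ρ : SpinorRep n t} {C : Spinor n →ₗ[ℂ] Spinor n →ₗ[ℂ] ℂ} {Δ₀ Δ₁ : ℤ}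

lemma eq_zero_of_forall_left (hC : IsChargeConjugation ρ C Δ₀ Δ₁) {ψ : Spinor n}
    (h : ∀ φ, C φ ψ = 0) : ψ = 0 :=
  hC.nondegenerate ψ fun φ => by rw [hC.symm₀, h, mul_zero]

lemma isAdj_unique (hC : IsChargeConjugation ρ C Δ₀ Δ₁) {A B B' : Module.End ℂ (Spinor n)}
    (h : IsAdj C A B) (h' : IsAdj C A B') : B = B' := by
  refine LinearMap.ext fun ψ => sub_eq_zero.1 (hC.eq_zero_of_forall_left fun φ => ?_)
  rw [map_sub, ← h φ ψ, ← h' φ ψ, sub_self]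

/-- Flipping with `symm₀` and then using `symm₁` yields the sign `Δ₀Δ₁`, the only way in which the
two symmetries enter the adjoints. -/
lemma isAdj_vec (hC : IsChargeConjugation ρ C Δ₀ Δ₁) (v : Fin (2 * n) → ℝ) :
    IsAdj C (ρ.vec v) (((Δ₀ * Δ₁ : ℤ) : ℂ) • ρ.vec v) := fun φ ψ => by
  rw [hC.symm₀, hC.symm₁, LinearMap.smul_apply, map_smul, Int.cast_mul, smul_eq_mul, mul_assoc]

lemma isAdj_gammaUp (hC : IsChargeConjugation ρ C Δ₀ Δ₁) (a : Fin (2 * n)) :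
    IsAdj C (ρ.gammaUp a) (((Δ₀ * Δ₁ : ℤ) : ℂ) • ρ.gammaUp a) := by
  rw [SpinorRep.gammaUp, smul_comm]
  exact (hC.isAdj_vec _).real_smul _

lemma isAdj_gammaProd (hC : IsChargeConjugation ρ C Δ₀ Δ₁) {ℓ : ℕ} {a : Fin ℓ → Fin (2 * n)}
    (ha : Function.Injective a) :
    IsAdj C (ρ.gammaProd a)
      ((((Δ₀ * Δ₁ : ℤ) : ℂ) ^ ℓ * (-1) ^ ℓ.choose 2) • ρ.gammaProd a) := by
  have h := IsAdj.list_prod hC.isAdj_gammaUp (List.ofFn a)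
  rw [prod_map_reverse_of_anticommute (fun a b h => ρ.gammaUp_anticomm h)
    (List.nodup_ofFn.2 ha), ← ρ.gammaProd_eq, List.length_ofFn] at h
  rw [mul_smul]
  convert h using 2
  have e := neg_one_pow_eq_smul (A := Module.End ℂ (Spinor n)) (ℓ.choose 2)
  refine Eq.trans ?_ (congrArg (· * ρ.gammaProd a) e).symm
  simp only [smul_mul_assoc, one_mul]

/-- The reversal sign is only valid for distinct indices; the vanishing of `f` on repeated indices,
as for an alternating form, makes the sign uniform. -/
lemma isAdj_sum_gammaProd (hC : IsChargeConjugation ρ C Δ₀ Δ₁) {ℓ : ℕ}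
    {f : (Fin ℓ → Fin (2 * n)) → ℂ} (hf : ∀ a, ¬ Function.Injective a → f a = 0) :
    IsAdj C (∑ a, f a • ρ.gammaProd a)
      ((((Δ₀ * Δ₁ : ℤ) : ℂ) ^ ℓ * (-1) ^ ℓ.choose 2) • ∑ a, f a • ρ.gammaProd a) := by
  rw [Finset.smul_sum]
  refine IsAdj.sum fun a _ => ?_
  by_cases ha : Function.Injective a
  · rw [smul_comm]
    exact (hC.isAdj_gammaProd ha).smul _
  · simp only [hf a ha, zero_smul, smul_zero]
    exact fun φ ψ => by simp

lemma sign_mul_sq (hC : IsChargeConjugation ρ C Δ₀ Δ₁) : (Δ₀ * Δ₁) ^ 2 = 1 := by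
  rcases hC.sign₀ with rfl | rfl <;> rcases hC.sign₁ with rfl | rfl <;> norm_num

/-- For `ℓ = 2n` the factor `d^{2n}` is `1`, and `(2n).choose 2 = n(2n - 1)` has the parity of `n`.
-/
lemma isAdj_gammaStar (hC : IsChargeConjugation ρ C Δ₀ Δ₁) :
    IsAdj C ρ.gammaStar ((-1 : ℂ) ^ n • ρ.gammaStar) := by
  have h := (hC.isAdj_gammaProd (a := (id : Fin (2 * n) → Fin (2 * n))) Function.injective_id).smul
    (if ((2 * n : ℤ) - 2 * t) % 4 = 0 then (1 : ℂ) else Complex.I)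
  rw [neg_one_pow_choose_two_mul, pow_mul, ← Int.cast_pow, hC.sign_mul_sq, Int.cast_one, one_pow,
    one_mul, smul_comm] at h
  exact h

lemma isAdj_chiralProj (hC : IsChargeConjugation ρ C Δ₀ Δ₁) (ε : ℤˣ) :
    IsAdj C (ρ.chiralProj ε) (ρ.chiralProj (ε * (-1) ^ n)) := by
  have h := (IsAdj.one.add (hC.isAdj_gammaStar.smul ((ε : ℤ) : ℂ))).smul (2 : ℂ)⁻¹
  simpa [SpinorRep.chiralProj, smul_smul] using h

end IsChargeConjugation

lemma neg_one_pow_choose_two (q r : ℕ) (hr : r < 4) :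
    (-1 : ℤ) ^ (4 * q + r).choose 2 = if r < 2 then 1 else -1 := by
  induction q with
  | zero => interval_cases r <;> rfl
  | succ q ih =>
    rw [← ih, show 4 * (q + 1) + r = 4 * q + r + 1 + 1 + 1 + 1 by ring]
    simp only [Nat.choose_succ_succ' _ 1, Nat.choose_one_right]
    rw [show ∀ k m : ℕ, k + 1 + 1 + 1 + (k + 1 + 1 + (k + 1 + (k + m))) = 2 * (2 * k + 3) + m by
      intros; ring, pow_add, pow_mul]
    simp

/-- For `n` and `ℓ` odd, `d^{ℓ+1} = 1` and the binomial sign alone decides. For both even, `d^{ℓ+1}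
= d` and the sign is `d (-1)^{ℓ/2}`. -/
lemma sign_eq_neg_one_iff {ℓ : ℕ} {d : ℤ} (hd : d = 1 ∨ d = -1) (h : Even (n + ℓ)) :
    d ^ (ℓ + 1) * (-1) ^ ℓ.choose 2 = -1 ↔
      (Odd n ∧ (ℓ : ℤ) ≡ 3 [ZMOD 4]) ∨ (Even n ∧ (ℓ : ℤ) ≡ 1 + d [ZMOD 4]) := by
  obtain ⟨q, r, hr, rfl⟩ : ∃ q r, r < 4 ∧ ℓ = 4 * q + r :=
    ⟨ℓ / 4, ℓ % 4, Nat.mod_lt _ (by norm_num), (Nat.div_add_mod _ _).symm⟩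
  rw [neg_one_pow_choose_two q r hr]
  have h4 : d ^ 4 = 1 := by rcases hd with rfl | rfl <;> norm_num
  rw [add_assoc, pow_add, pow_mul, h4, one_pow, one_mul]
  simp only [Int.ModEq, Nat.odd_iff, Nat.even_iff] at *
  rcases hd with rfl | rfl <;> interval_cases r <;> norm_num <;> omega

lemma even_add_of_condition {ℓ : ℕ} {d : ℤ} (hd : d = 1 ∨ d = -1)
    (h : (Odd n ∧ (ℓ : ℤ) ≡ 3 [ZMOD 4]) ∨ (Even n ∧ (ℓ : ℤ) ≡ 1 + d [ZMOD 4])) :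
    Even (n + ℓ) := by
  simp only [Int.ModEq, Nat.odd_iff, Nat.even_iff] at *
  rcases hd with rfl | rfl <;> omega

/-- The obstruction to admissibility defined by `S = F_{a₁⋯a_ℓ} γ^{a₁⋯a_ℓ}`. -/
def obstruction (ρ : SpinorRep n t) (ε : ℤˣ) (d : ℤ) (ℓ : ℕ) (S : Module.End ℂ (Spinor n)) :
    Module.End ℂ (Spinor n) :=
  S * ρ.chiralProj (-ε) +
    ((d : ℂ) ^ (ℓ + 1) * (-1) ^ ℓ.choose 2) • (ρ.chiralProj (-ε * (-1) ^ n) * S)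

/-- Moving the left projection through `S` reduces everything to the parity of `n + ℓ`: either both
terms carry the same projection and combine to `(1 + c) S Π^{-ε}`, or they carry complementary ones
and cannot cancel. -/
lemma obstruction_eq_zero_iff {ρ : SpinorRep n t} {C : Spinor n →ₗ[ℂ] Spinor n →ₗ[ℂ] ℂ}
    {Δ₀ Δ₁ : ℤ} (hC : IsChargeConjugation ρ C Δ₀ Δ₁) (ht : t ≤ 2 * n) (ε : ℤˣ) {ℓ : ℕ}
    {S : Module.End ℂ (Spinor n)}
    (hS : IsAdj C S ((((Δ₀ * Δ₁ : ℤ) : ℂ) ^ ℓ * (-1) ^ ℓ.choose 2) • S))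
    (hSP : ∀ ε, S * ρ.chiralProj ε = ρ.chiralProj (ε * (-1) ^ ℓ) * S) :
    obstruction ρ ε (Δ₀ * Δ₁) ℓ S = 0 ↔ S * ρ.chiralProj (-ε) = 0 ∨
      (Odd n ∧ (ℓ : ℤ) ≡ 3 [ZMOD 4]) ∨ (Even n ∧ (ℓ : ℤ) ≡ 1 + Δ₀ * Δ₁ [ZMOD 4]) := by
  have hd : Δ₀ * Δ₁ = 1 ∨ Δ₀ * Δ₁ = -1 := by
    rcases hC.sign₀ with rfl | rfl <;> rcases hC.sign₁ with rfl | rfl <;> norm_num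
  set d := Δ₀ * Δ₁
  have hd0 : (d : ℂ) ≠ 0 := by rcases hd with h | h <;> simp [h]
  -- The second term of the obstruction is, up to a nonzero scalar, the adjoint of the first.
  have hz : S * ρ.chiralProj (-ε) = 0 → ρ.chiralProj (-ε * (-1) ^ n) * S = 0 := by
    intro h
    have h1 := hS.mul (hC.isAdj_chiralProj (-ε))
    rw [h] at h1
    have h2 := hC.isAdj_unique h1 (B' := 0) fun φ ψ => by simp
    rw [mul_smul_comm] at h2
    refine (smul_eq_zero.1 h2).resolve_left ?_
    exact mul_ne_zero (pow_ne_zero _ hd0) (pow_ne_zero _ (by norm_num))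
  have hswap : ρ.chiralProj (-ε * (-1) ^ n) * S = S * ρ.chiralProj (-ε * (-1) ^ (n + ℓ)) := by
    rw [hSP, pow_add, mul_assoc, mul_assoc, ← mul_pow]; simp
  have hcast : ((d : ℂ) ^ (ℓ + 1) * (-1) ^ ℓ.choose 2) =
      ((d ^ (ℓ + 1) * (-1) ^ ℓ.choose 2 : ℤ) : ℂ) := by push_cast; rfl
  by_cases hpar : Even (n + ℓ)
  · rw [← sign_eq_neg_one_iff hd hpar, obstruction, hswap, hpar.neg_one_pow, mul_one, hcast]
    nth_rewrite 1 [← one_smul ℂ (S * _)]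
    rw [← add_smul, smul_eq_zero, or_comm]
    refine or_congr_right ?_
    rw [← Int.cast_one, ← Int.cast_add, Int.cast_eq_zero]
    constructor <;> intro h <;> linarith
  · have hno : ¬ ((Odd n ∧ (ℓ : ℤ) ≡ 3 [ZMOD 4]) ∨ (Even n ∧ (ℓ : ℤ) ≡ 1 + d [ZMOD 4])) :=
      fun h => hpar (even_add_of_condition hd h)
    rw [or_iff_left hno]
    constructor
    · intro h
      -- The second term carries `Π^ε` on the right, so right multiplication by `Π^{-ε}` isolates
      -- the first.
      have h1 := congrArg (· * ρ.chiralProj (-ε)) h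
      simp only [obstruction, hswap, (Nat.not_even_iff_odd.1 hpar).neg_one_pow, add_mul,
        smul_mul_assoc, mul_assoc, zero_mul, ρ.chiralProj_mul_self ht, mul_neg, mul_one, neg_neg,
        ρ.chiralProj_mul_neg ht, mul_zero, smul_zero, add_zero] at h1
      exact h1
    · intro h
      rw [obstruction, hz h, h, smul_zero, add_zero]

end Gamma

/-! ### The spin Lie algebra acting on vectors and spinors -/

section SpinAlgebra

section Generic

variable {A κ : Type*} [Ring A] [Algebra ℝ A] [Fintype κ]

/-- The element `¼ ∑ w_{cb} γ^b γ^c`. For skew symmetric `w` and gamma matrices `γ^b` it belongs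
to the spin Lie algebra. -/
def spinElement (G : κ → A) (w : κ → κ → ℝ) : A :=
  (4 : ℝ)⁻¹ • ∑ b, ∑ c, w c b • (G b * G c)

/-- Here `G c` stands for `γ^c` and `L` for `γ_a`. The Clifford relation gives `[γ^b γ^c, γ_a] =
2δ^b_a γ^c - 2δ^c_a γ^b`; by skewness of `w` both terms contribute equally, which the factor `¼`
normalises. -/
lemma spinElement_commutator [DecidableEq κ] {G : κ → A} {w : κ → κ → ℝ}
    (hw : ∀ b c, w b c = -w c b) {L : A} {a : κ}
    (h : ∀ c, G c * L = -(L * G c) - (if c = a then (2 : ℝ) else 0) • 1) :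
    spinElement G w * L - L * spinElement G w = ∑ c, w c a • G c := by
  have key : ∀ b c, G b * G c * L - L * (G b * G c) =
      (if b = a then (2 : ℝ) else 0) • G c - (if c = a then (2 : ℝ) else 0) • G b := by
    intro b c
    rw [mul_assoc, h, mul_sub, mul_neg, ← mul_assoc, h]
    simp only [sub_mul, neg_mul, mul_assoc, mul_smul_comm, smul_mul_assoc, mul_one, one_mul]
    abel
  have h1 : spinElement G w * L - L * spinElement G w =
      (4 : ℝ)⁻¹ • ∑ b, ∑ c, w c b • (G b * G c * L - L * (G b * G c)) := by
    simp only [spinElement, smul_mul_assoc, mul_smul_comm, Finset.sum_mul, Finset.mul_sum,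
      smul_sub, Finset.sum_sub_distrib]
  have h2 : ∑ b, w a b • (2 : ℝ) • G b = -∑ b, w b a • (2 : ℝ) • G b := by
    rw [← Finset.sum_neg_distrib]
    exact Finset.sum_congr rfl fun b _ => by rw [hw a b, neg_smul]
  rw [h1]
  simp only [key, smul_sub, Finset.sum_sub_distrib, ite_smul, zero_smul, smul_ite, smul_zero,
    Finset.sum_ite_eq', Finset.mem_univ, if_true]
  rw [Finset.sum_comm]
  simp only [Finset.sum_ite_eq', Finset.mem_univ, if_true]
  rw [h2, smul_neg, sub_neg_eq_add, ← smul_add, ← Finset.sum_add_distrib, Finset.smul_sum]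
  refine Finset.sum_congr rfl fun b _ => ?_
  module

lemma spinElement_reverse {G : κ → A} {w : κ → κ → ℝ} (hw : ∀ b c, w b c = -w c b) :
    (4 : ℝ)⁻¹ • ∑ b, ∑ c, w c b • (G c * G b) = -spinElement G w := by
  rw [spinElement, ← smul_neg, Finset.sum_comm, ← Finset.sum_neg_distrib]
  simp only [← Finset.sum_neg_distrib, ← neg_smul]
  exact congrArg _ (Finset.sum_congr rfl fun b _ => Finset.sum_congr rfl fun c _ => by
    rw [hw b c])

lemma mul_eq_of_anticommute {x y : A} {c s d : ℝ} (h : x * y + y * x = c • 1)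
    (hs : s * c = -d) : (s • x) * y = -(y * (s • x)) - d • 1 := by
  rw [smul_mul_assoc, eq_sub_of_add_eq h, mul_smul_comm, smul_sub, smul_smul, hs, neg_smul]
  abel

end Generic

variable {n t : ℕ} (ρ : SpinorRep n t)

lemma gammaUp_mul_vec_single (a c : Fin (2 * n)) :
    ρ.gammaUp c * ρ.vec (Pi.single a 1) =
      -(ρ.vec (Pi.single a 1) * ρ.gammaUp c) - (if c = a then (2 : ℝ) else 0) • 1 := by
  refine mul_eq_of_anticommute (ρ.vec_mul_vec_add (Pi.single c 1) (Pi.single a 1)) ?_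
  rw [minkowski_single]
  split_ifs
  · rw [mul_left_comm, sgn_mul_self]; norm_num
  · simp

/-- Since `d² = 1`, the adjoint of `γ^b γ^c` is `γ^c γ^b`, and relabelling the sum turns this
reversal into the sign of the skew coefficients. -/
lemma isAdj_spinElement {ρ : SpinorRep n t} {C : Spinor n →ₗ[ℂ] Spinor n →ₗ[ℂ] ℂ} {Δ₀ Δ₁ : ℤ}
    (hC : IsChargeConjugation ρ C Δ₀ Δ₁)
    {w : Fin (2 * n) → Fin (2 * n) → ℝ} (hw : ∀ b c, w b c = -w c b) :
    IsAdj C (spinElement ρ.gammaUp w) (-spinElement ρ.gammaUp w) := by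
  rw [← spinElement_reverse hw]
  refine IsAdj.real_smul _ (IsAdj.sum fun b _ => IsAdj.sum fun c _ => IsAdj.real_smul _ ?_)
  have h := (hC.isAdj_gammaUp b).mul (hC.isAdj_gammaUp c)
  rwa [smul_mul_smul_comm, ← sq, ← Int.cast_pow, hC.sign_mul_sq, Int.cast_one, one_smul] at h

end SpinAlgebra

/-! ### Product rules for manifold derivatives -/

section Calculus

variable {E' H' M' : Type*} [NormedAddCommGroup E'] [NormedSpace ℝ E'] [TopologicalSpace H']
  {I : ModelWithCorners ℝ E' H'} [TopologicalSpace M'] [ChartedSpace H' M']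
  {F G K : Type*} [NormedAddCommGroup F] [NormedSpace ℝ F] [NormedAddCommGroup G]
  [NormedSpace ℝ G] [NormedAddCommGroup K] [NormedSpace ℝ K]

lemma mvfderiv_eq_of_hasMFDerivAt {u : M' → F} {x : M'} {u' : E' →L[ℝ] F}
    (h : HasMFDerivAt I 𝓘(ℝ, F) u x u') (Z : TangentSpace I x) :
    mvfderiv I u x Z = u' Z :=
  congrArg (fun L : E' →L[ℝ] F => L Z) h.mfderiv

lemma mvfderiv_congr {u v : M' → F} {x : M'} (h : u =ᶠ[𝓝 x] v) :
    mvfderiv I u x = mvfderiv I v x :=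
  h.mfderiv_eq (I := I) (I' := 𝓘(ℝ, F))

lemma mvfderiv_bilinear (B : F →L[ℝ] G →L[ℝ] K) {u : M' → F} {v : M' → G} {x : M'}
    (hu : MDifferentiableAt I 𝓘(ℝ, F) u x) (hv : MDifferentiableAt I 𝓘(ℝ, G) v x)
    (Z : TangentSpace I x) :
    mvfderiv I (fun y => B (u y) (v y)) x Z =
      B (u x) (mvfderiv I v x Z) + B (mvfderiv I u x Z) (v x) := by
  have h3 := B.hasFDerivWithinAt_of_bilinear hu.hasMFDerivAt.2 hv.hasMFDerivAt.2
  have hc : ContinuousAt (fun y => B (u y) (v y)) x :=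
    (B.continuous.continuousAt.comp hu.continuousAt).clm_apply hv.continuousAt
  refine (mvfderiv_eq_of_hasMFDerivAt (I := I) ⟨hc, h3⟩ Z).trans ?_
  simp [writtenInExtChartAt]
  rfl

end Calculus

/-! ### Local orthonormal frames and the spin connection form -/

section Manifold

variable {n : ℕ} {M : Type*} [TopologicalSpace M] [ChartedSpace (E n) M]
  [IsManifold (mdl n) ∞ M]

lemma covariantDerivative_sum_smul (nab : TangentConnection n M) {κ : Type*} (S : Finset κ)
    {f : κ → M → ℝ} {e : κ → (x : M) → TangentSpace (mdl n) x} {x : M}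
    (hf : ∀ k ∈ S, MDifferentiableAt (mdl n) 𝓘(ℝ, ℝ) (f k) x)
    (he : ∀ k ∈ S, MDifferentiableAt (mdl n) (mdl n).tangent
      (fun y => (⟨y, e k y⟩ : TangentBundle (mdl n) M)) x) (Z : TangentSpace (mdl n) x) :
    nab (fun y => ∑ k ∈ S, f k y • e k y) x Z =
      ∑ k ∈ S, (f k x • nab (e k) x Z + mvfderiv (mdl n) (f k) x Z • e k x) := by
  classical
  induction S using Finset.induction_on with
  | empty =>
    simp only [Finset.sum_empty]
    have := nab.zero
    exact congrArg (fun T => T x Z) this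
  | insert k S hk ih =>
    have hf' : ∀ k ∈ S, _ := fun k hk => hf k (Finset.mem_insert_of_mem hk)
    have he' : ∀ k ∈ S, _ := fun k hk => he k (Finset.mem_insert_of_mem hk)
    have h1 : MDifferentiableAt (mdl n) (mdl n).tangent
        (fun y => (⟨y, ∑ k ∈ S, f k y • e k y⟩ : TangentBundle (mdl n) M)) x :=
      MDifferentiableAt.sum_section fun k hk => (hf' k hk).smul_section (he' k hk)
    have h2 : MDifferentiableAt (mdl n) (mdl n).tangent
        (fun y => (⟨y, f k y • e k y⟩ : TangentBundle (mdl n) M)) x :=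
      (hf k (Finset.mem_insert_self _ _)).smul_section (he k (Finset.mem_insert_self _ _))
    have h3 := nab.isCovariantDerivativeOnUniv.add (σ := f k • e k) h2 h1
    have h4 := nab.isCovariantDerivativeOnUniv.leibniz (he k (Finset.mem_insert_self _ _))
      (hf k (Finset.mem_insert_self _ _))
    rw [Finset.sum_insert hk, ← ih hf' he']
    have e1 : (fun y => ∑ k ∈ insert k S, f k y • e k y) =
        f k • e k + fun y => ∑ k ∈ S, f k y • e k y := by
      funext y
      exact Finset.sum_insert hk
    rw [e1, h3, h4]
    rfl

lemma PseudoRiemannianMetric.mdifferentiableAt (g : PseudoRiemannianMetric n M)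
    {X Y : (x : M) → TangentSpace (mdl n) x} {x : M}
    (hX : MDifferentiableAt (mdl n) (mdl n).tangent
      (fun y => (⟨y, X y⟩ : TangentBundle (mdl n) M)) x)
    (hY : MDifferentiableAt (mdl n) (mdl n).tangent
      (fun y => (⟨y, Y y⟩ : TangentBundle (mdl n) M)) x) :
    MDifferentiableAt (mdl n) 𝓘(ℝ, ℝ) (fun y => g.val y (X y) (Y y)) x := by
  have h : MDifferentiableAt (mdl n) ((mdl n).prod 𝓘(ℝ, ℝ)) (fun y =>
      TotalSpace.mk' ℝ (E := Bundle.Trivial M ℝ) y (g.val y (X y) (Y y))) x :=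
    MDifferentiableAt.clm_bundle_apply₂ (F₁ := E n) (F₂ := E n)
      ((g.contMDiff x).mdifferentiableAt (by simp)) hX hY
  rw [mdifferentiableAt_section] at h
  exact h

lemma PseudoRiemannianMetric.contMDiffAt (g : PseudoRiemannianMetric n M)
    {X Y : (x : M) → TangentSpace (mdl n) x} {x : M}
    (hX : ContMDiffAt (mdl n) (mdl n).tangent ∞
      (fun y => (⟨y, X y⟩ : TangentBundle (mdl n) M)) x)
    (hY : ContMDiffAt (mdl n) (mdl n).tangent ∞
      (fun y => (⟨y, Y y⟩ : TangentBundle (mdl n) M)) x) :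
    ContMDiffAt (mdl n) 𝓘(ℝ, ℝ) ∞ (fun y => g.val y (X y) (Y y)) x := by
  have h : ContMDiffAt (mdl n) ((mdl n).prod 𝓘(ℝ, ℝ)) ∞ (fun y =>
      TotalSpace.mk' ℝ (E := Bundle.Trivial M ℝ) y (g.val y (X y) (Y y))) x :=
    ContMDiffAt.clm_bundle_apply₂ (F₁ := E n) (F₂ := E n) (g.contMDiff x) hX hY
  rw [contMDiffAt_section] at h
  exact h

namespace SpinStructure

variable {ι : Type*} {t : ℕ} {g : PseudoRiemannianMetric n M}

section Frame

variable (s : SpinStructure ι t g)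

/-- The components of a tangent vector in the frame with index `i`. -/
def compAt (i : ι) (x : M) : TangentSpace (mdl n) x →ₗ[ℝ] (Fin (2 * n) → ℝ) :=
  LinearMap.pi fun a => sgn n t a • (g.val x (s.frame i a x)).toLinearMap

lemma compAt_apply (i : ι) (x : M) (v : TangentSpace (mdl n) x) (a : Fin (2 * n)) :
    s.compAt i x v a = sgn n t a * g.val x (s.frame i a x) v := rfl

lemma compAt_sum {i : ι} {x : M} (hx : x ∈ s.baseSet i) (c : Fin (2 * n) → ℝ) :
    s.compAt i x (∑ a, c a • s.frame i a x) = c := by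
  funext b
  rw [compAt_apply, map_sum]
  simp only [map_smul, smul_eq_mul, s.orthonormal i x hx, mul_ite, mul_zero, Finset.sum_ite_eq,
    Finset.mem_univ, if_true]
  rw [mul_left_comm, sgn_mul_self, mul_one]

lemma compAt_frame {i : ι} {x : M} (hx : x ∈ s.baseSet i) (a : Fin (2 * n)) :
    s.compAt i x (s.frame i a x) = Pi.single a 1 := by
  have := s.compAt_sum hx (Pi.single a 1)
  simpa [Pi.single_apply] using this

/-- Orthonormality makes the component map surjective, and equality of dimensions makes it
injective, so the frame spans. -/
lemma sum_compAt {i : ι} {x : M} (hx : x ∈ s.baseSet i) (v : TangentSpace (mdl n) x) :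
    ∑ a, s.compAt i x v a • s.frame i a x = v := by
  have hsurj : Function.Surjective (s.compAt i x) := fun c => ⟨_, s.compAt_sum hx c⟩
  have hdim : Module.finrank ℝ (TangentSpace (mdl n) x) =
      Module.finrank ℝ (Fin (2 * n) → ℝ) := by
    have : Module.finrank ℝ (E n) = Module.finrank ℝ (Fin (2 * n) → ℝ) := by simp
    exact this
  have : FiniteDimensional ℝ (TangentSpace (mdl n) x) := inferInstanceAs (FiniteDimensional ℝ (E n))
  have hinj := (LinearMap.injective_iff_surjective_of_finrank_eq_finrank hdim).2 hsurj
  exact hinj (s.compAt_sum hx _)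

lemma baseSet_mem_nhds {i : ι} {x : M} (hx : x ∈ s.baseSet i) : s.baseSet i ∈ 𝓝 x :=
  (s.isOpen_baseSet i).mem_nhds hx

lemma contMDiffAt_frame {i : ι} {x : M} (hx : x ∈ s.baseSet i) (a : Fin (2 * n)) :
    ContMDiffAt (mdl n) (mdl n).tangent ∞
      (fun y => (⟨y, s.frame i a y⟩ : TangentBundle (mdl n) M)) x :=
  (s.contMDiffOn_frame i a).contMDiffAt (s.baseSet_mem_nhds hx)

lemma mdifferentiableAt_frame {i : ι} {x : M} (hx : x ∈ s.baseSet i) (a : Fin (2 * n)) :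
    MDifferentiableAt (mdl n) (mdl n).tangent
      (fun y => (⟨y, s.frame i a y⟩ : TangentBundle (mdl n) M)) x :=
  (s.contMDiffAt_frame hx a).mdifferentiableAt (by simp)

/-- The coefficients `g(e_c, ∇_Z e_b)` of the Levi-Civita connection in a local frame. -/
def connCoeff (nab : TangentConnection n M) (i : ι) (x : M) (Z : TangentSpace (mdl n) x)
    (c b : Fin (2 * n)) : ℝ :=
  g.val x (s.frame i c x) (nab (s.frame i b) x Z)

/-- Metric compatibility is applied to `g(e_b, e_c)`, which is constant near `x`. -/
lemma connCoeff_skew {nab : TangentConnection n M} (hnab : IsLeviCivita g nab) {i : ι} {x : M}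
    (hx : x ∈ s.baseSet i) (Z : TangentSpace (mdl n) x) (b c : Fin (2 * n)) :
    s.connCoeff nab i x Z b c = -s.connCoeff nab i x Z c b := by
  have h := hnab.metric (s.frame i b) (s.frame i c) x (s.mdifferentiableAt_frame hx b)
    (s.mdifferentiableAt_frame hx c) Z
  have hc : (fun y => g.val y (s.frame i b y) (s.frame i c y)) =ᶠ[𝓝 x]
      fun _ => if b = c then sgn n t b else 0 := by
    filter_upwards [s.baseSet_mem_nhds hx] with y hy using s.orthonormal i y hy b c
  rw [mvfderiv_congr hc, mvfderiv_const] at h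
  rw [g.symm x (nab (s.frame i b) x Z)] at h
  simp only [connCoeff]
  have h0 : (0 : TangentSpace (mdl n) x →L[ℝ] ℝ) Z = 0 := rfl
  linarith

end Frame

variable (s : SpinStructure ι t g) (ρ : SpinorRep n t)

lemma gamma_nabla_frame (nab : TangentConnection n M) (x : M) (Z : TangentSpace (mdl n) x)
    (b : Fin (2 * n)) :
    s.gamma ρ x (nab (s.frame (s.indexAt x) b) x Z) =
      ∑ c, s.connCoeff nab (s.indexAt x) x Z c b • ρ.gammaUp c := by
  change ρ.vec (s.compAt (s.indexAt x) x _) = _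
  rw [ρ.vec_eq_sum]
  refine Finset.sum_congr rfl fun c _ => ?_
  rw [compAt_apply, ← mul_assoc, sgn_mul_self, one_mul]
  rfl

lemma spinForm_eq (nab : TangentConnection n M) (x : M) (Z : TangentSpace (mdl n) x) :
    s.spinForm ρ nab x Z =
      spinElement ρ.gammaUp (s.connCoeff nab (s.indexAt x) x Z) := by
  have h : s.spinForm ρ nab x Z = (4 : ℝ)⁻¹ • ∑ b, ρ.gammaUp b *
      s.gamma ρ x (nab (s.frame (s.indexAt x) b) x Z) := by
    simp only [spinForm, LinearMap.smul_apply, LinearMap.sum_apply]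
    rfl
  rw [h, spinElement]
  simp only [gamma_nabla_frame, Finset.mul_sum, mul_smul_comm]

/-- In a spin frame, the commutator with the connection form differentiates the frame. -/
lemma spinForm_commutator {nab : TangentConnection n M} (hnab : IsLeviCivita g nab) (x : M)
    (Z : TangentSpace (mdl n) x) (a : Fin (2 * n)) :
    s.spinForm ρ nab x Z * ρ.vec (Pi.single a 1) - ρ.vec (Pi.single a 1) * s.spinForm ρ nab x Z =
      s.gamma ρ x (nab (s.frame (s.indexAt x) a) x Z) := by
  rw [spinForm_eq, gamma_nabla_frame]
  exact spinElement_commutator (s.connCoeff_skew hnab (s.mem_baseSet_at x) Z)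
    (gammaUp_mul_vec_single ρ a)

lemma isAdj_spinForm {ρ : SpinorRep n t} {C : Spinor n →ₗ[ℂ] Spinor n →ₗ[ℂ] ℂ} {Δ₀ Δ₁ : ℤ}
    (hC : IsChargeConjugation ρ C Δ₀ Δ₁) {nab : TangentConnection n M}
    (hnab : IsLeviCivita g nab) (x : M) (Z : TangentSpace (mdl n) x) :
    IsAdj C (s.spinForm ρ nab x Z) (-s.spinForm ρ nab x Z) := by
  rw [spinForm_eq]
  exact isAdj_spinElement hC (s.connCoeff_skew hnab (s.mem_baseSet_at x) Z)

lemma localRep_self (ψ : (x : M) → s.Fib ρ x) (x : M) : s.localRep ρ ψ x x = ψ x :=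
  (s.core ρ).coordChange_self _ x ((s.core ρ).mem_baseSet_at x) (ψ x)

/-- The spin cocycle intertwines the Clifford actions of the components in two frames, so Clifford
multiplication, defined with the frame chosen at `y`, can be read in the fixed frame chosen at `x`
and differentiated there. -/
lemma localRep_cliff (X : (x : M) → TangentSpace (mdl n) x) (ξ : (x : M) → s.Fib ρ x) {x y : M}
    (hy : y ∈ s.baseSet (s.indexAt x)) :
    s.localRep ρ (fun y => s.cliff ρ (X y) (ξ y)) x y =
      ρ.vec (s.compAt (s.indexAt x) y (X y)) (s.localRep ρ ξ x y) := by
  have h := s.trans_covers (s.indexAt y) (s.indexAt x) y ⟨s.mem_baseSet_at y, hy⟩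
    (s.compAt (s.indexAt y) y (X y)) (s.compAt (s.indexAt x) y (X y))
    ((s.sum_compAt (s.mem_baseSet_at y) (X y)).trans (s.sum_compAt hy (X y)).symm)
  have h' := congrArg ρ h
  rw [map_mul, map_mul] at h'
  exact congrArg (fun T : Module.End ℂ (Spinor n) => T (ξ y)) h'

lemma leviCivita_apply (nab : TangentConnection n M) (ψ : (x : M) → s.Fib ρ x) (x : M)
    (Z : TangentSpace (mdl n) x) :
    s.leviCivita ρ nab ψ x Z =
      mvfderiv (mdl n) (s.localRep ρ ψ x) x Z + s.spinForm ρ nab x Z (ψ x) := rfl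

/-- The Clifford product, as a continuous bilinear map. -/
def vecBilin : (Fin (2 * n) → ℝ) →L[ℝ] Spinor n →L[ℝ] Spinor n :=
  LinearMap.toContinuousBilinearMap
    (LinearMap.mk₂ ℝ (fun v φ => ρ.vec v φ) (fun v w φ => by simp) (fun c v φ => by simp)
      (fun v φ ψ => by simp) (fun c v φ => by simp))

/-- A complex bilinear form, as a continuous real bilinear map. -/
def formBilin (C : Spinor n →ₗ[ℂ] Spinor n →ₗ[ℂ] ℂ) : Spinor n →L[ℝ] Spinor n →L[ℝ] ℂ :=
  LinearMap.toContinuousBilinearMap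
    (LinearMap.mk₂ ℝ (fun φ ψ => C φ ψ) (fun v w φ => by simp) (fun c v φ => by simp)
      (fun v φ ψ => by simp) (fun c v φ => by simp))

end SpinStructure
end Manifold

lemma mvfderiv_clm_comp {E' H' M' : Type*} [NormedAddCommGroup E'] [NormedSpace ℝ E']
    [TopologicalSpace H'] {I : ModelWithCorners ℝ E' H'} [TopologicalSpace M'] [ChartedSpace H' M']
    {F G : Type*} [NormedAddCommGroup F] [NormedSpace ℝ F] [NormedAddCommGroup G]
    [NormedSpace ℝ G] (L : F →L[ℝ] G) {u : M' → F} {x : M'}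
    (hu : MDifferentiableAt I 𝓘(ℝ, F) u x) (Z : TangentSpace I x) :
    mvfderiv I (fun y => L (u y)) x Z = L (mvfderiv I u x Z) := by
  have h3 := L.hasFDerivAt.comp_hasFDerivWithinAt _ hu.hasMFDerivAt.2
  exact mvfderiv_eq_of_hasMFDerivAt (I := I)
    (u' := L ∘L (mfderiv I 𝓘(ℝ, F) u x : E' →L[ℝ] F))
    ⟨L.continuous.continuousAt.comp hu.continuousAt, h3⟩ Z

/-! ### Parallelism of Clifford multiplication and of the charge conjugation -/

section Manifold

variable {n : ℕ} {M : Type*} [TopologicalSpace M] [ChartedSpace (E n) M]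
  [IsManifold (mdl n) ∞ M]

namespace SpinStructure

variable {ι : Type*} {t : ℕ} {g : PseudoRiemannianMetric n M}
  (s : SpinStructure ι t g) (ρ : SpinorRep n t)

lemma spinForm_commutator_vec {nab : TangentConnection n M} (hnab : IsLeviCivita g nab) (x : M)
    (Z : TangentSpace (mdl n) x) (v : Fin (2 * n) → ℝ) :
    s.spinForm ρ nab x Z * ρ.vec v - ρ.vec v * s.spinForm ρ nab x Z =
      s.gamma ρ x (∑ a, v a • nab (s.frame (s.indexAt x) a) x Z) := by
  simp only [map_sum, map_smul, ← s.spinForm_commutator ρ hnab]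
  conv_lhs => rw [pi_eq_sum_univ' v, map_sum, Finset.mul_sum, Finset.sum_mul,
    ← Finset.sum_sub_distrib]
  refine Finset.sum_congr rfl fun a _ => ?_
  rw [map_smul, mul_smul_comm, smul_mul_assoc, smul_sub]

/-- The Levi-Civita connection on spinors is compatible with Clifford multiplication. -/
lemma leviCivita_cliff {nab : TangentConnection n M} (hnab : IsLeviCivita g nab)
    {X : (x : M) → TangentSpace (mdl n) x} {ξ : (x : M) → s.Fib ρ x} {x : M}
    (hX : MDifferentiableAt (mdl n) (mdl n).tangent
      (fun y => (⟨y, X y⟩ : TangentBundle (mdl n) M)) x)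
    (hξ : MDifferentiableAt (mdl n) ((mdl n).prod 𝓘(ℝ, Spinor n))
      (fun y => (⟨y, ξ y⟩ : TotalSpace (Spinor n) (s.Fib ρ))) x)
    (Z : TangentSpace (mdl n) x) :
    s.leviCivita ρ nab (fun y => s.cliff ρ (X y) (ξ y)) x Z =
      s.cliff ρ (nab X x Z) (ξ x) + s.cliff ρ (X x) (s.leviCivita ρ nab ξ x Z) := by
  set i := s.indexAt x with hi
  have hx : x ∈ s.baseSet i := s.mem_baseSet_at x
  have hfa : ∀ a, MDifferentiableAt (mdl n) 𝓘(ℝ, ℝ) (fun y => s.compAt i y (X y) a) x := fun a =>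
    (mdifferentiableAt_const (c := sgn n t a)).smul
      (g.mdifferentiableAt (s.mdifferentiableAt_frame hx a) hX)
  have hf : MDifferentiableAt (mdl n) 𝓘(ℝ, Fin (2 * n) → ℝ) (fun y => s.compAt i y (X y)) x :=
    mdifferentiableAt_iff _ _ |>.2 ⟨continuousAt_pi.2 fun a => (hfa a).continuousAt,
      differentiableWithinAt_pi.2 fun a => ((mdifferentiableAt_iff _ _).1 (hfa a)).2⟩
  have hψ := s.mdifferentiableAt_localRep ρ hξ
  set w := mvfderiv (mdl n) (fun y => s.compAt i y (X y)) x Z with hw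
  have hwa : ∀ a, mvfderiv (mdl n) (fun y => s.compAt i y (X y) a) x Z = w a := fun a =>
    mvfderiv_clm_comp (ContinuousLinearMap.proj (R := ℝ) (φ := fun _ : Fin (2 * n) => ℝ) a) hf Z
  have hnabX : nab X x Z = ∑ a, (s.compAt i x (X x) a • nab (s.frame i a) x Z +
      w a • s.frame i a x) := by
    simp only [← hwa]
    rw [← covariantDerivative_sum_smul nab Finset.univ (fun a _ => hfa a)
      fun a _ => s.mdifferentiableAt_frame hx a]
    refine congrArg (fun T : TangentSpace (mdl n) x →L[ℝ] TangentSpace (mdl n) x => T Z) ?_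
    refine nab.isCovariantDerivativeOnUniv.congr_of_eventuallyEq hX
      (MDifferentiableAt.sum_section fun a _ =>
        (hfa a).smul_section (s.mdifferentiableAt_frame hx a)) Filter.univ_mem ?_
    filter_upwards [s.baseSet_mem_nhds hx] with y hy using (s.sum_compAt hy (X y)).symm
  have hloc : s.localRep ρ (fun y => s.cliff ρ (X y) (ξ y)) x =ᶠ[𝓝 x]
      fun y => vecBilin ρ (s.compAt i y (X y)) (s.localRep ρ ξ x y) := by
    filter_upwards [s.baseSet_mem_nhds hx] with y hy using s.localRep_cliff ρ X ξ hy
  -- The derivatives of the frame become the commutator with the connection form; the derivatives of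
  -- the components become `ρ.vec w`. These are the extra terms of the product rule below.
  have hγ : s.gamma ρ x (nab X x Z) =
      s.spinForm ρ nab x Z * ρ.vec (s.compAt i x (X x)) -
        ρ.vec (s.compAt i x (X x)) * s.spinForm ρ nab x Z + ρ.vec w := by
    rw [hnabX, Finset.sum_add_distrib, map_add, s.spinForm_commutator_vec ρ hnab]
    congr 1
    exact congrArg ρ.vec (s.compAt_sum hx w)
  rw [leviCivita_apply, leviCivita_apply, mvfderiv_congr hloc, mvfderiv_bilinear _ hf hψ,
    localRep_self]
  let φ : Spinor n := ξ x
  let dψ : Spinor n := mvfderiv (mdl n) (s.localRep ρ ξ x) x Z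
  let Ω : Module.End ℂ (Spinor n) := s.spinForm ρ nab x Z
  let v := s.compAt i x (X x)
  change ρ.vec v dψ + ρ.vec w φ + Ω (ρ.vec v φ) =
    s.gamma ρ x (nab X x Z) φ + ρ.vec v (dψ + Ω φ)
  rw [hγ]
  change ρ.vec v dψ + ρ.vec w φ + Ω (ρ.vec v φ) =
    (Ω (ρ.vec v φ) - ρ.vec v (Ω φ) + ρ.vec w φ) + ρ.vec v (dψ + Ω φ)
  rw [map_add]
  abel

/-- The Levi-Civita connection on spinors makes a charge conjugation parallel. -/
lemma mvfderiv_chargeConjugation {ρ : SpinorRep n t} {C : Spinor n →ₗ[ℂ] Spinor n →ₗ[ℂ] ℂ}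
    {Δ₀ Δ₁ : ℤ} (hC : IsChargeConjugation ρ C Δ₀ Δ₁) {nab : TangentConnection n M}
    (hnab : IsLeviCivita g nab) {φ ψ : (x : M) → s.Fib ρ x} {x : M}
    (hφ : MDifferentiableAt (mdl n) ((mdl n).prod 𝓘(ℝ, Spinor n))
      (fun y => (⟨y, φ y⟩ : TotalSpace (Spinor n) (s.Fib ρ))) x)
    (hψ : MDifferentiableAt (mdl n) ((mdl n).prod 𝓘(ℝ, Spinor n))
      (fun y => (⟨y, ψ y⟩ : TotalSpace (Spinor n) (s.Fib ρ))) x)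
    (Z : TangentSpace (mdl n) x) :
    mvfderiv (mdl n) (fun y => C (φ y) (ψ y)) x Z =
      C (s.leviCivita ρ nab φ x Z) (ψ x) + C (φ x) (s.leviCivita ρ nab ψ x Z) := by
  have hx := s.mem_baseSet_at x
  -- `C` is evaluated in the frame chosen at each `y`; spin invariance permits replacing it by the
  -- single frame chosen at `x`.
  have hloc : (fun y => C (φ y) (ψ y)) =ᶠ[𝓝 x]
      fun y => formBilin C (s.localRep ρ φ x y) (s.localRep ρ ψ x y) := by
    filter_upwards [s.baseSet_mem_nhds hx] with y hy
    exact (hC.spin_invariant _ (s.trans_mem _ _ y ⟨s.mem_baseSet_at y, hy⟩) _ _).symm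
  rw [mvfderiv_congr hloc, mvfderiv_bilinear _ (s.mdifferentiableAt_localRep ρ hφ)
    (s.mdifferentiableAt_localRep ρ hψ), leviCivita_apply, leviCivita_apply, localRep_self,
    localRep_self]
  let φ₀ : Spinor n := φ x
  let ψ₀ : Spinor n := ψ x
  let dφ : Spinor n := mvfderiv (mdl n) (s.localRep ρ φ x) x Z
  let dψ : Spinor n := mvfderiv (mdl n) (s.localRep ρ ψ x) x Z
  let Ω : Module.End ℂ (Spinor n) := s.spinForm ρ nab x Z
  change C φ₀ dψ + C dφ ψ₀ = C (dφ + Ω φ₀) ψ₀ + C φ₀ (dψ + Ω ψ₀)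
  have h : C (Ω φ₀) ψ₀ = C φ₀ ((-Ω) ψ₀) := s.isAdj_spinForm hC hnab x Z φ₀ ψ₀
  rw [map_add, LinearMap.add_apply, h, map_add, LinearMap.neg_apply, map_neg]
  ring

end SpinStructure
end Manifold

/-! ### Global sections with a prescribed value, and the pointwise form of admissibility -/

lemma exists_contMDiff_section_eq {E' H' M' : Type*} [NormedAddCommGroup E'] [NormedSpace ℝ E']
    [FiniteDimensional ℝ E'] [TopologicalSpace H'] {I : ModelWithCorners ℝ E' H'}
    [TopologicalSpace M'] [ChartedSpace H' M'] [IsManifold I ∞ M'] [T2Space M']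
    (F : Type*) [NormedAddCommGroup F] [NormedSpace ℝ F]
    {V : M' → Type*} [TopologicalSpace (TotalSpace F V)] [∀ x, AddCommGroup (V x)]
    [∀ x, Module ℝ (V x)] [∀ x, TopologicalSpace (V x)] [FiberBundle F V] [VectorBundle ℝ F V]
    [ContMDiffVectorBundle ∞ F V I] {x : M'} (v : V x) :
    ∃ σ : (y : M') → V y, ContMDiff I (I.prod 𝓘(ℝ, F)) ∞
      (fun y => (⟨y, σ y⟩ : TotalSpace F V)) ∧ σ x = v := by
  obtain ⟨u, hu, hsm⟩ := FiberBundle.exists_contMDiffOn_extend (k := ∞) I F v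
  obtain ⟨o, hou, ho, hxo⟩ := mem_nhds_iff.1 hu
  obtain ⟨f, -, hf⟩ := (SmoothBumpFunction.nhds_basis_tsupport (I := I) x).mem_iff.1
    (ho.mem_nhds hxo)
  refine ⟨fun y => f y • FiberBundle.extend F v y,
    f.contMDiff.contMDiffOn.smul_section_of_tsupport ho hf (hsm.mono hou), ?_⟩
  simp

section Manifold

variable {n : ℕ} {M : Type*} [TopologicalSpace M] [ChartedSpace (E n) M]
  [IsManifold (mdl n) ∞ M]

namespace SpinStructure

variable {ι : Type*} {t : ℕ} {g : PseudoRiemannianMetric n M}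
  {s : SpinStructure ι t g} {ρ : SpinorRep n t}

lemma addForm_apply (D : s.SpinorConnection ρ)
    (B : (x : M) → TangentSpace (mdl n) x →ₗ[ℝ] Module.End ℂ (Spinor n))
    (ψ : (x : M) → s.Fib ρ x) (x : M) (Z : TangentSpace (mdl n) x) :
    addForm D B ψ x Z = D ψ x Z + s.applyFib ρ (B x) (ψ x) Z := rfl

section Admissible

variable {C : Spinor n →ₗ[ℂ] Spinor n →ₗ[ℂ] ℂ} {Δ₀ Δ₁ : ℤ}
  {nab : TangentConnection n M}
  {A A' : (x : M) → TangentSpace (mdl n) x →ₗ[ℝ] Module.End ℂ (Spinor n)}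

/-- Since `∇` makes `C` parallel, the term `C(Aφ, ψ) = C(φ, A'ψ)` has to be cancelled by `-A'`. -/
lemma isConjugate_addForm (hC : IsChargeConjugation ρ C Δ₀ Δ₁) (hnab : IsLeviCivita g nab)
    (hA : ∀ x Z, IsAdj C (A x Z) (A' x Z)) :
    IsConjugate C (addForm (s.leviCivita ρ nab) A)
      (addForm (s.leviCivita ρ nab) fun x => -A' x) := by
  intro φ ψ hφ hψ x Z
  rw [s.mvfderiv_chargeConjugation hC hnab ((hφ x).mdifferentiableAt (by simp))
    ((hψ x).mdifferentiableAt (by simp)), addForm_apply, addForm_apply]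
  have h := hA x Z (φ x) (ψ x)
  let φ₀ : Spinor n := φ x
  let ψ₀ : Spinor n := ψ x
  let dφ : Spinor n := s.leviCivita ρ nab φ x Z
  let dψ : Spinor n := s.leviCivita ρ nab ψ x Z
  change C (A x Z φ₀) ψ₀ = C φ₀ (A' x Z ψ₀) at h
  change C dφ ψ₀ + C φ₀ dψ = C (dφ + A x Z φ₀) ψ₀ + C φ₀ (dψ + (-A' x Z) ψ₀)
  rw [map_add, LinearMap.add_apply, h, map_add, LinearMap.neg_apply, map_neg]
  ring

/-- Testing against sections `φ` of arbitrary value at `x`, nondegeneracy of `C` determines the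
conjugate connection. Thus the existential in `IsAdmissible` may be evaluated at `∇ - A'`. -/
lemma IsConjugate.eq_of_isConjugate [T2Space M] (hC : IsChargeConjugation ρ C Δ₀ Δ₁)
    {D D' D'' : s.SpinorConnection ρ} (h' : IsConjugate C D D') (h'' : IsConjugate C D D'')
    {ψ : (x : M) → s.Fib ρ x} (hψ : s.IsSmoothSection ρ ψ) (x : M) (Z : TangentSpace (mdl n) x) :
    D' ψ x Z = D'' ψ x Z := by
  have key : ∀ φ₀ : Spinor n, C φ₀ (D' ψ x Z) = C φ₀ (D'' ψ x Z) := by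
    intro φ₀
    obtain ⟨φ, hφ, e⟩ := exists_contMDiff_section_eq (I := mdl n) (Spinor n) (V := s.Fib ρ)
      (x := x) φ₀
    have := (h' φ ψ hφ hψ x Z).symm.trans (h'' φ ψ hφ hψ x Z)
    rw [e] at this
    exact add_left_cancel this
  let a : Spinor n := D' ψ x Z
  let b : Spinor n := D'' ψ x Z
  have : a - b = 0 := hC.eq_zero_of_forall_left fun φ₀ => by
    rw [map_sub, sub_eq_zero]; exact key φ₀
  exact sub_eq_zero.1 this

/-- Compatibility of `∇` with Clifford multiplication cancels every derivative of `X` and `ξ`,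
leaving a tensorial expression. -/
lemma hatGamma_addForm (hnab : IsLeviCivita g nab) {Z X : (x : M) → TangentSpace (mdl n) x}
    {ξ : (x : M) → s.Fib ρ x} (hX : IsSmoothVF X) (hξ : s.IsSmoothSection ρ ξ) (x : M) :
    hatGamma nab (addForm (s.leviCivita ρ nab) A)
        (addForm (s.leviCivita ρ nab) fun x => -A' x) Z X ξ x =
      (A x (Z x) * s.gamma ρ x (X x) + s.gamma ρ x (X x) * A' x (Z x) :
        Module.End ℂ (Spinor n)) (ξ x) := by
  rw [hatGamma, addForm_apply, addForm_apply, s.leviCivita_cliff ρ hnab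
    ((hX x).mdifferentiableAt (by simp)) ((hξ x).mdifferentiableAt (by simp))]
  let ξ₀ : Spinor n := ξ x
  let dξ : Spinor n := s.leviCivita ρ nab ξ x (Z x)
  let G := s.gamma ρ x (X x)
  let N := s.gamma ρ x (nab X x (Z x))
  change (N ξ₀ + G dξ + A x (Z x) (G ξ₀)) - N ξ₀ - G (dξ + (-A' x (Z x)) ξ₀) =
    A x (Z x) (G ξ₀) + G (A' x (Z x) ξ₀)
  rw [map_add, LinearMap.neg_apply, map_neg]
  abel

/-- The condition on fields is tensorial, and every vector or spinor at a point extends to a global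
smooth section, so it is equivalent to its pointwise version. -/
lemma isAdmissible_addForm_iff [T2Space M] (hC : IsChargeConjugation ρ C Δ₀ Δ₁)
    (hnab : IsLeviCivita g nab) (hA : ∀ x Z, IsAdj C (A x Z) (A' x Z)) :
    IsAdmissible nab C (addForm (s.leviCivita ρ nab) A) ↔
      ∀ (x : M) (Z X : TangentSpace (mdl n) x),
        A x Z * s.gamma ρ x X + s.gamma ρ x X * A' x Z =
          -(A x X * s.gamma ρ x Z + s.gamma ρ x Z * A' x X) := by
  constructor
  · rintro ⟨D', hD', h⟩ x Z₀ X₀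
    refine LinearMap.ext fun ξ₀ => ?_
    obtain ⟨Z, hZ, rfl⟩ := exists_contMDiff_section_eq (I := mdl n) (E n)
      (V := fun x : M => TangentSpace (mdl n) x) (x := x) Z₀
    obtain ⟨X, hX, rfl⟩ := exists_contMDiff_section_eq (I := mdl n) (E n)
      (V := fun x : M => TangentSpace (mdl n) x) (x := x) X₀
    obtain ⟨ξ, hξ, rfl⟩ := exists_contMDiff_section_eq (I := mdl n) (Spinor n) (V := s.Fib ρ)
      (x := x) ξ₀
    have hD : ∀ Z X : (x : M) → TangentSpace (mdl n) x,
        hatGamma nab (addForm (s.leviCivita ρ nab) A) D' Z X ξ x =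
        hatGamma nab (addForm (s.leviCivita ρ nab) A)
          (addForm (s.leviCivita ρ nab) fun x => -A' x) Z X ξ x := fun Z X => by
      rw [hatGamma, hatGamma,
        hD'.eq_of_isConjugate hC (isConjugate_addForm hC hnab hA) hξ x (Z x)]
    have := h Z X ξ hZ hX hξ x
    rw [hD, hD, hatGamma_addForm hnab hX hξ, hatGamma_addForm hnab hZ hξ] at this
    exact this
  · intro h
    refine ⟨_, isConjugate_addForm hC hnab hA, fun Z X ξ hZ hX hξ x => ?_⟩
    rw [hatGamma_addForm hnab hX hξ, hatGamma_addForm hnab hZ hξ, h]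
    rfl

end Admissible

end SpinStructure
end Manifold

/-! ### The symmetrised contribution of an `ℓ`-form -/

section Manifold

variable {n : ℕ} {M : Type*} [TopologicalSpace M] [ChartedSpace (E n) M]
  [IsManifold (mdl n) ∞ M]

namespace SpinStructure

variable {ι : Type*} {t : ℕ} {g : PseudoRiemannianMetric n M}
  (s : SpinStructure ι t g) (ρ : SpinorRep n t)

section FormGamma

variable {ℓ : ℕ} {x : M} (F : TangentSpace (mdl n) x [⋀^Fin ℓ]→ₗ[ℝ] ℂ)

lemma formGamma_eq : s.formGamma ρ x F =
    ∑ a : Fin ℓ → Fin (2 * n), F (fun k => s.frame (s.indexAt x) (a k) x) • ρ.gammaProd a := by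
  refine ρ.sum_smul_gammaAlt fun a σ => ?_
  have h := F.map_perm (fun k => s.frame (s.indexAt x) (a k) x) σ
  refine h.trans ?_
  rw [Units.smul_def, zsmul_eq_mul]

lemma isAdj_formGamma {ρ : SpinorRep n t} {C : Spinor n →ₗ[ℂ] Spinor n →ₗ[ℂ] ℂ} {Δ₀ Δ₁ : ℤ}
    (hC : IsChargeConjugation ρ C Δ₀ Δ₁) :
    IsAdj C (s.formGamma ρ x F)
      ((((Δ₀ * Δ₁ : ℤ) : ℂ) ^ ℓ * (-1) ^ ℓ.choose 2) • s.formGamma ρ x F) := by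
  rw [formGamma_eq]
  exact hC.isAdj_sum_gammaProd fun a ha => F.map_eq_zero_of_not_injective _ fun h =>
    ha fun i j hij => h (by simp only [hij])

lemma formGamma_mul_chiralProj (ε : ℤˣ) :
    s.formGamma ρ x F * ρ.chiralProj ε = ρ.chiralProj (ε * (-1) ^ ℓ) * s.formGamma ρ x F := by
  rw [formGamma_eq, Finset.sum_mul, Finset.mul_sum]
  refine Finset.sum_congr rfl fun a _ => ?_
  rw [smul_mul_assoc, ρ.gammaProd_mul_chiralProj, mul_smul_comm]

end FormGamma

lemma gamma_mul_gamma_add (x : M) (X Z : TangentSpace (mdl n) x) :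
    s.gamma ρ x X * s.gamma ρ x Z + s.gamma ρ x Z * s.gamma ρ x X =
      (-2 * minkowski n t (s.comp x X) (s.comp x Z)) • 1 :=
  ρ.vec_mul_vec_add _ _

lemma gamma_mul_chiralProj (x : M) (X : TangentSpace (mdl n) x) (ε : ℤˣ) :
    s.gamma ρ x X * ρ.chiralProj ε = ρ.chiralProj (-ε) * s.gamma ρ x X :=
  ρ.vec_mul_chiralProj _ _

/-- Carrying the projections across one vector places the two vectors side by side; symmetrising
then yields their anticommutator, a scalar. The application has `G = γ(Z)`, `K = γ(X)`, with `P`,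
`P'` and `Q`, `Q'` pairs of opposite projections. -/
lemma symmetrized_eq_smul {A : Type*} [Ring A] [Algebra ℝ A] [Algebra ℂ A]
    {S P P' Q Q' G K : A} {r : ℝ} {c : ℂ} (hr : G * K + K * G = r • 1)
    (hGP : G * P' = P * G) (hKP : K * P' = P * K) (hGQ : G * Q = Q' * G) (hKQ : K * Q = Q' * K) :
    S * (G * P) * K + K * (c • Q * (G * S)) + (S * (K * P) * G + G * (c • Q * (K * S))) =
      r • (S * P') + r • (c • (Q' * S)) := by
  have e1 : S * (G * P) * K + S * (K * P) * G = S * (G * K + K * G) * P' := by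
    simp only [mul_assoc, ← hGP, ← hKP, mul_add, add_mul]
  have e2 : K * (c • Q * (G * S)) + G * (c • Q * (K * S)) = c • (Q' * (G * K + K * G) * S) := by
    simp only [smul_mul_assoc, mul_smul_comm, ← smul_add]
    rw [← mul_assoc K, ← mul_assoc G, hGQ, hKQ]
    simp only [mul_add, add_mul, mul_assoc, add_comm]
  rw [add_add_add_comm, e1, e2, hr]
  simp only [smul_mul_assoc, mul_smul_comm, mul_one]
  rw [Algebra.smul_def c, Algebra.smul_def c, mul_smul_comm]

/-- The adjoint of the contribution of a form with respect to a charge conjugation. -/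
def contributionAdj (ε : ℤˣ) (d : ℤ) {ℓ : ℕ}
    (F : (x : M) → TangentSpace (mdl n) x [⋀^Fin ℓ]→ₗ[ℝ] ℂ) (x : M) :
    TangentSpace (mdl n) x →ₗ[ℝ] Module.End ℂ (Spinor n) :=
  LinearMap.mulLeft ℝ (((d : ℂ) ^ (ℓ + 1) * (-1) ^ ℓ.choose 2) • ρ.chiralProj (ε * (-1) ^ n)) ∘ₗ
    LinearMap.mulRight ℝ (s.formGamma ρ x (F x)) ∘ₗ s.gamma ρ x

section Contribution

variable {ℓ : ℕ} (ε : ℤˣ) (F : (x : M) → TangentSpace (mdl n) x [⋀^Fin ℓ]→ₗ[ℝ] ℂ)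

lemma contribution_apply (x : M) (X : TangentSpace (mdl n) x) :
    s.contribution ρ ε F x X =
      s.formGamma ρ x (F x) * (s.gamma ρ x X * ρ.chiralProj ε) := rfl

lemma contributionAdj_apply (d : ℤ) (x : M) (X : TangentSpace (mdl n) x) :
    s.contributionAdj ρ ε d F x X =
      (((d : ℂ) ^ (ℓ + 1) * (-1) ^ ℓ.choose 2) • ρ.chiralProj (ε * (-1) ^ n)) *
        (s.gamma ρ x X * s.formGamma ρ x (F x)) := rfl

lemma isAdj_contribution {ρ : SpinorRep n t} {C : Spinor n →ₗ[ℂ] Spinor n →ₗ[ℂ] ℂ} {Δ₀ Δ₁ : ℤ}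
    (hC : IsChargeConjugation ρ C Δ₀ Δ₁) (x : M) (X : TangentSpace (mdl n) x) :
    IsAdj C (s.contribution ρ ε F x X) (s.contributionAdj ρ ε (Δ₀ * Δ₁) F x X) := by
  have h := (s.isAdj_formGamma (F x) hC).mul
    ((hC.isAdj_vec (s.comp x X)).mul (hC.isAdj_chiralProj ε))
  rw [mul_smul_comm, mul_smul_comm, smul_mul_assoc, smul_smul, mul_right_comm, ← pow_succ,
    mul_assoc] at h
  rw [contributionAdj_apply, smul_mul_assoc]
  exact h

/-- `S γ(X) Π^ε = S Π^{-ε} γ(X)`, so a contribution with `S Π^{-ε} = 0` everywhere would vanish. -/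
lemma exists_formGamma_mul_chiralProj_ne_zero (h : s.contribution ρ ε F ≠ 0) :
    ∃ x, s.formGamma ρ x (F x) * ρ.chiralProj (-ε) ≠ 0 := by
  by_contra! h0
  refine h (funext fun x => LinearMap.ext fun X => ?_)
  rw [contribution_apply, gamma_mul_chiralProj, ← mul_assoc, h0, zero_mul]
  rfl

variable {ε F}

lemma isAdmissible_contribution_iff [T2Space M] {ρ : SpinorRep n t}
    {C : Spinor n →ₗ[ℂ] Spinor n →ₗ[ℂ] ℂ} {Δ₀ Δ₁ : ℤ} (hn : 1 ≤ n) (ht : t ≤ 2 * n)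
    (hC : IsChargeConjugation ρ C Δ₀ Δ₁) {nab : TangentConnection n M}
    (hnab : IsLeviCivita g nab) :
    IsAdmissible nab C (addForm (s.leviCivita ρ nab) (s.contribution ρ ε F)) ↔
      ∀ x, s.formGamma ρ x (F x) * ρ.chiralProj (-ε) = 0 ∨
        (Odd n ∧ (ℓ : ℤ) ≡ 3 [ZMOD 4]) ∨ (Even n ∧ (ℓ : ℤ) ≡ 1 + Δ₀ * Δ₁ [ZMOD 4]) := by
  rw [isAdmissible_addForm_iff hC hnab fun x X => s.isAdj_contribution ε F hC x X]
  refine forall_congr' fun x => ?_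
  rw [← obstruction_eq_zero_iff hC ht ε (s.isAdj_formGamma (F x) hC)
    (s.formGamma_mul_chiralProj ρ (F x))]
  have key : ∀ Z X : TangentSpace (mdl n) x,
      s.contribution ρ ε F x Z * s.gamma ρ x X +
          s.gamma ρ x X * s.contributionAdj ρ ε (Δ₀ * Δ₁) F x Z +
        (s.contribution ρ ε F x X * s.gamma ρ x Z +
          s.gamma ρ x Z * s.contributionAdj ρ ε (Δ₀ * Δ₁) F x X) =
      (-2 * minkowski n t (s.comp x Z) (s.comp x X)) •
        obstruction ρ ε (Δ₀ * Δ₁) ℓ (s.formGamma ρ x (F x)) := by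
    intro Z X
    have hP : ∀ Y : TangentSpace (mdl n) x,
        s.gamma ρ x Y * ρ.chiralProj (-ε) = ρ.chiralProj ε * s.gamma ρ x Y := fun Y => by
      rw [gamma_mul_chiralProj, neg_neg]
    have hQ : ∀ Y : TangentSpace (mdl n) x,
        s.gamma ρ x Y * ρ.chiralProj (ε * (-1) ^ n) =
          ρ.chiralProj (-ε * (-1) ^ n) * s.gamma ρ x Y := fun Y => by
      rw [gamma_mul_chiralProj, neg_mul]
    rw [obstruction, smul_add]
    exact symmetrized_eq_smul (s.gamma_mul_gamma_add ρ x Z X) (hP Z) (hP X) (hQ Z) (hQ X)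
  constructor
  · intro h
    -- A frame vector satisfies `g(X, X) = ±1`, so taking `Z = X` allows division by the scalar in
    -- `key`.
    let a : Fin (2 * n) := ⟨0, by omega⟩
    let X := s.frame (s.indexAt x) a x
    have hX : s.comp x X = Pi.single a 1 := s.compAt_frame (s.mem_baseSet_at x) a
    have h2 := (eq_neg_iff_add_eq_zero.1 (h X X)).symm.trans (key X X)
    rw [hX, minkowski_single, if_pos rfl] at h2
    exact (smul_eq_zero.1 h2.symm).resolve_left (mul_ne_zero (by norm_num) (sgn_ne_zero a))
  · intro h Z X
    rw [eq_neg_iff_add_eq_zero, key, h, smul_zero]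

end Contribution

end SpinStructure
end Manifold

/-! ### Smooth test forms with invertible gamma contraction -/

section Manifold

variable {n : ℕ} {M : Type*} [TopologicalSpace M] [ChartedSpace (E n) M]
  [IsManifold (mdl n) ∞ M]

namespace SpinStructure

variable {ι : Type*} {t : ℕ} {g : PseudoRiemannianMetric n M}
  (s : SpinStructure ι t g) (ρ : SpinorRep n t)

section TestForm

variable {ℓ : ℕ} (f : M → ℝ) (i : ι) (b : Fin ℓ → Fin (2 * n))

/-- The wedge product of the one-forms `f g(e_{b_k}, ·)`, for the local frame `e` with index `i`
and a function `f`. -/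
def frameForm (x : M) : TangentSpace (mdl n) x [⋀^Fin ℓ]→ₗ[ℝ] ℂ :=
  Complex.ofRealCLM.toLinearMap.compAlternatingMap
    (Matrix.detRowAlternating.compLinearMap
      (LinearMap.pi fun k => f x • (g.val x (s.frame i (b k) x)).toLinearMap))

lemma frameForm_apply (x : M) (v : Fin ℓ → TangentSpace (mdl n) x) :
    s.frameForm f i b x v =
      ((Matrix.of fun j k => f x * g.val x (s.frame i (b k) x) (v j)).det : ℝ) := rfl

variable {f i}

lemma isSmoothForm_frameForm (hf : ContMDiff (mdl n) 𝓘(ℝ, ℝ) ∞ f)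
    (hfi : tsupport f ⊆ s.baseSet i) : IsSmoothForm (s.frameForm f i b) := by
  intro X hX
  have hentry : ∀ j k, ContMDiff (mdl n) 𝓘(ℝ, ℝ) ∞
      fun x => f x * g.val x (s.frame i (b k) x) (X j x) := by
    intro j k
    -- The frame is only controlled on its base set; the cut-off `f` makes the entry vanish away
    -- from it.
    refine contMDiff_of_tsupport fun x hx => ?_
    have hx' : x ∈ s.baseSet i := hfi (tsupport_mul_subset_left hx)
    exact (hf x).smul (g.contMDiffAt (s.contMDiffAt_frame hx' (b k)) (hX j x))
  have hdet : ContDiff ℝ ∞ fun m : Fin ℓ → Fin ℓ → ℝ => ((Matrix.of m).det : ℂ) := by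
    have h : ContDiff ℝ ∞ fun m : Fin ℓ → Fin ℓ → ℝ => (Matrix.of m).det := by
      simp only [Matrix.det_apply', Matrix.of_apply]
      fun_prop
    exact Complex.ofRealCLM.contDiff.comp h
  exact hdet.comp_contMDiff (contMDiff_pi_space.2 fun j => contMDiff_pi_space.2 fun k => hentry j k)

/-- In the Leibniz expansion of the determinant, orthonormality kills the term of `σ` unless `a = b
∘ σ`. -/
lemma frameForm_frame {x : M} (hx : x ∈ s.baseSet i) (hfx : f x = 1)
    (a : Fin ℓ → Fin (2 * n)) :
    s.frameForm f i b x (fun k => s.frame i (a k) x) =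
      ∑ σ : Equiv.Perm (Fin ℓ), if a = b ∘ σ then
        ((Equiv.Perm.sign σ : ℤ) : ℂ) * ∏ k, (sgn n t (b k) : ℂ) else 0 := by
  rw [frameForm_apply, ← Matrix.det_transpose, Matrix.det_apply', Complex.ofReal_sum]
  refine Finset.sum_congr rfl fun σ _ => ?_
  simp only [Matrix.transpose_apply, Matrix.of_apply, hfx, one_mul, s.orthonormal i x hx]
  split_ifs with h
  · subst h
    simp [Equiv.prod_comp σ fun k => (sgn n t (b k) : ℂ)]
  · obtain ⟨k, hk⟩ : ∃ k, b (σ k) ≠ a k := by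
      by_contra! h0
      exact h (funext fun k => (h0 k).symm)
    rw [Finset.prod_eq_zero (Finset.mem_univ k) (if_neg hk)]
    simp

/-- The sign of `σ` in the form cancels the sign from reordering the anticommuting product, so `ℓ!`
equal terms remain. -/
lemma formGamma_frameForm (hb : Function.Injective b) {x : M} (hfx : f x = 1) :
    s.formGamma ρ x (s.frameForm f (s.indexAt x) b x) =
      ((Nat.factorial ℓ : ℂ) * ∏ k, (sgn n t (b k) : ℂ)) • ρ.gammaProd b := by
  have hσ : ∀ σ : Equiv.Perm (Fin ℓ), ∀ c : ℂ, (((Equiv.Perm.sign σ : ℤ) : ℂ) * c) •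
      ρ.gammaProd (b ∘ σ) = c • ρ.gammaProd b := by
    intro σ c
    rw [ρ.gammaProd_comp_perm hb]
    rcases Int.units_eq_one_or (Equiv.Perm.sign σ) with h | h <;> simp [h]
  simp only [formGamma_eq, s.frameForm_frame b (s.mem_baseSet_at x) hfx, Finset.sum_smul, ite_smul,
    zero_smul]
  rw [Finset.sum_comm]
  simp only [Finset.sum_ite_eq', Finset.mem_univ, if_true, hσ]
  rw [Finset.sum_const, Finset.card_univ, Fintype.card_perm, Fintype.card_fin, mul_smul,
    Nat.cast_smul_eq_nsmul]

end TestForm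

/-- In every degree at most `2n` there is a smooth form whose contraction with the gamma matrices
is invertible at a given point. -/
lemma exists_isSmoothForm_isUnit_formGamma [T2Space M] {ℓ : ℕ} (hℓ : ℓ ≤ 2 * n) (x : M) :
    ∃ F : (x : M) → TangentSpace (mdl n) x [⋀^Fin ℓ]→ₗ[ℝ] ℂ,
      IsSmoothForm F ∧ IsUnit (s.formGamma ρ x (F x)) := by
  obtain ⟨f, -, hf⟩ := (SmoothBumpFunction.nhds_basis_tsupport (I := mdl n) x).mem_iff.1
    (s.baseSet_mem_nhds (s.mem_baseSet_at x))
  refine ⟨s.frameForm f (s.indexAt x) (Fin.castLE hℓ),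
    s.isSmoothForm_frameForm _ f.contMDiff hf, ?_⟩
  rw [s.formGamma_frameForm ρ _ (Fin.castLE_injective hℓ) f.eq_one]
  have hc : (Nat.factorial ℓ : ℂ) * ∏ k, (sgn n t (Fin.castLE hℓ k) : ℂ) ≠ 0 :=
    mul_ne_zero (Nat.cast_ne_zero.2 (Nat.factorial_ne_zero ℓ))
      (Finset.prod_ne_zero_iff.2 fun k _ => Complex.ofReal_ne_zero.2 (sgn_ne_zero _))
  exact (ρ.isUnit_gammaProd _).smul (Units.mk0 _ hc)

end SpinStructure
end Manifold

end SpinGeometry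

end

/-! ### The admissibility criterion -/

theorem corollary4p8 (n t : ℕ) (hn : 1 ≤ n) (ht : t ≤ 2 * n)
    {M : Type*} [TopologicalSpace M] [T2Space M] [SecondCountableTopology M] [Nonempty M]
    [ChartedSpace (SpinGeometry.E n) M] [IsManifold (SpinGeometry.mdl n) ∞ M]
    (g : SpinGeometry.PseudoRiemannianMetric n M)
    (nab : SpinGeometry.TangentConnection n M) (hnab : SpinGeometry.IsLeviCivita g nab)
    {ι : Type*} (s : SpinGeometry.SpinStructure ι t g)
    (ρ : SpinGeometry.SpinorRep n t)
    (C : SpinGeometry.Spinor n →ₗ[ℂ] SpinGeometry.Spinor n →ₗ[ℂ] ℂ) (Δ₀ Δ₁ : ℤ)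
    (hC : SpinGeometry.IsChargeConjugation ρ C Δ₀ Δ₁)
    (ε : ℤˣ) (ℓ : ℕ) :
    (∀ F : (x : M) → TangentSpace (SpinGeometry.mdl n) x [⋀^Fin ℓ]→ₗ[ℝ] ℂ,
      SpinGeometry.IsSmoothForm F → s.contribution ρ ε F ≠ 0 →
      (SpinGeometry.SpinStructure.IsAdmissible nab C
            (SpinGeometry.SpinStructure.addForm (s.leviCivita ρ nab) (s.contribution ρ ε F)) ↔
        (Odd n ∧ (ℓ : ℤ) ≡ 3 [ZMOD 4]) ∨ (Even n ∧ (ℓ : ℤ) ≡ 1 + Δ₀ * Δ₁ [ZMOD 4]))) ∧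
    (ℓ ≤ 2 * n →
      ((∀ F : (x : M) → TangentSpace (SpinGeometry.mdl n) x [⋀^Fin ℓ]→ₗ[ℝ] ℂ,
        SpinGeometry.IsSmoothForm F →
        SpinGeometry.SpinStructure.IsAdmissible nab C
            (SpinGeometry.SpinStructure.addForm (s.leviCivita ρ nab) (s.contribution ρ ε F))) ↔
        (Odd n ∧ (ℓ : ℤ) ≡ 3 [ZMOD 4]) ∨ (Even n ∧ (ℓ : ℤ) ≡ 1 + Δ₀ * Δ₁ [ZMOD 4]))) := by
  refine ⟨fun F _ hF => ?_, fun hℓ => ⟨fun h => ?_, fun h F _ => ?_⟩⟩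
  · rw [s.isAdmissible_contribution_iff hn ht hC hnab]
    refine ⟨fun h => ?_, fun h _ => Or.inr h⟩
    obtain ⟨x, hx⟩ := s.exists_formGamma_mul_chiralProj_ne_zero ρ ε F hF
    exact (h x).resolve_left hx
  · obtain ⟨x⟩ := ‹Nonempty M›
    obtain ⟨F, hF, hu⟩ := s.exists_isSmoothForm_isUnit_formGamma ρ hℓ x
    refine ((s.isAdmissible_contribution_iff hn ht hC hnab).1 (h F hF) x).resolve_left fun h0 => ?_
    -- With `S` invertible at `x`, the alternative `S Π^{-ε} = 0` would force the projection itself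
    -- to vanish.
    exact ρ.chiralProj_ne_zero hn (-ε) (hu.mul_right_eq_zero.1 h0)
  · exact (s.isAdmissible_contribution_iff hn ht hC hnab).2 fun _ => Or.inr h
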